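/- Let $n\ge 2$ and let $M$ be a smooth manifold (Hausdorff, second countable, without boundary) of dimension $4n$. Let $H=(J_1,J_2,J_3)$ be an almost hypercomplex structure on $M$, i.e. smooth fields of endomorphisms of $TM$ with $J_\alpha^2=-I$ and $J_\alpha=J_\beta J_\gamma=-J_\gamma J_\beta$ for all cyclic permutations $(\alpha,\beta,\gamma)$ of $(1,2,3)$, and let $g$ be a smooth pseudo-Riemannian metric on $M$ with $$g(J_1x,J_1y)=g(x,y),\qquad g(J_2x,J_2y)=g(J_3x,J_3y)=-g(x,y)$$ (so $g$ is Hermitian for $J_1$, a Norden metric for $J_2$ and $J_3$, and automatically of neutral signature). Let $\nabla$ be the Levi-Civita connection of $g$ and, for a local basis $(e_i)$ and the inverse matrix $(g^{ij})$ of $(g(e_i,e_j))$, put $\theta_\alpha(z)=g^{ij}\,g\bigl((\nabla_{e_i}J_\alpha)e_j,z\bigr)$. Assume that $(M,H,g)$ is quaternionic Kähler, i.e. locally there are 1-forms $\omega_1,\omega_2,\omega_3$ with $(\nabla_xJ_\alpha)y=\omega_\gamma(x)J_\beta y-\omega_\beta(x)J_\gamma y$ for all cyclic permutations $(\alpha,\beta,\gamma)$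 of $(1,2,3)$, and that it is determined locally by a 1-form $\omega_1$ through $$(\nabla_xJ_1)y=0,\qquad (\nabla_xJ_2)y=\omega_1(x)J_3y,\qquad (\nabla_xJ_3)y=-\omega_1(x)J_2y,$$ where $\omega_1(x)=-\theta_2(J_3x)=\theta_3(J_2x)$. Let $R(x,y)z=\nabla_x\nabla_yz-\nabla_y\nabla_xz-\nabla_{[x,y]}z$ be the curvature, $\rho(y,z)=g^{ij}g(R(e_i,y)z,e_j)$ the Ricci tensor and $\tau=g^{ij}\rho(e_i,e_j)$ the scalar curvature. Then $\tau$ is constant on every connected component of $M$ (hence constant if $M$ is connected), and $M$ is Ricci-symmetric: $\nabla\rho=0$. -/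

import Mathlib

open Bundle FiberBundle
open scoped Manifold ContDiff Topology

noncomputable section

namespace NHGeometry

variable {m : ℕ} {M : Type*} [TopologicalSpace M]
  [ChartedSpace (EuclideanSpace ℝ (Fin m)) M]

/-- The basis `e₁, …, e_m` of `T_p M` that is used to write contractions in components. (It is the
coordinate basis of the preferred chart at `p`; contractions do not depend on the choice.) -/
def frameVec (p : M) (i : Fin m) : TangentSpace (𝓡 m) p :=
  (EuclideanSpace.single i (1 : ℝ) : EuclideanSpace ℝ (Fin m))

/-- The contraction `g^{ij} B(e_i, e_j)` of a (bilinear) function `B` on `T_p M` with respect to a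
nondegenerate bilinear form `g` on `T_p M`; here `(g^{ij})` is the inverse of the matrix
`(g(e_i, e_j))`. -/
def metricTrace {p : M}
    (g : TangentSpace (𝓡 m) p →L[ℝ] TangentSpace (𝓡 m) p →L[ℝ] ℝ)
    (B : TangentSpace (𝓡 m) p → TangentSpace (𝓡 m) p → ℝ) : ℝ :=
  ∑ i : Fin m, ∑ j : Fin m,
    (Matrix.of fun k l : Fin m => g (frameVec p k) (frameVec p l))⁻¹ i j *
      B (frameVec p i) (frameVec p j)

variable [IsManifold (𝓡 m) ∞ M]

/-- A `(0,2)`-tensor field `T` is parallel for the connection `∇`: for vector fields `Y`, `Z` that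
are differentiable at `p`, the function `T(Y, Z)` is differentiable at `p` and
`x (T(Y, Z)) = T(∇_x Y, Z) + T(Y, ∇_x Z)` for all `x ∈ T_p M`.
In Mathlib's notation `∇_x Y` at `p` is `nabla Y p x`. -/
def IsParallelTwoTensor
    (nabla : CovariantDerivative (𝓡 m) (EuclideanSpace ℝ (Fin m)) (TangentSpace (𝓡 m) : M → Type _))
    (T : ∀ p : M, TangentSpace (𝓡 m) p → TangentSpace (𝓡 m) p → ℝ) : Prop :=
  ∀ (p : M) (Y Z : ∀ q : M, TangentSpace (𝓡 m) q),
    MDifferentiableAt (𝓡 m) (𝓡 m).tangent (T% Y) p →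
    MDifferentiableAt (𝓡 m) (𝓡 m).tangent (T% Z) p →
      MDifferentiableAt (𝓡 m) 𝓘(ℝ, ℝ) (fun q => T q (Y q) (Z q)) p ∧
      ∀ x : TangentSpace (𝓡 m) p,
        mvfderiv (𝓡 m) (fun q => T q (Y q) (Z q)) p x = T p (nabla Y p x) (Z p) + T p (Y p) (nabla Z p x)

/-- `∇` is the Levi-Civita connection of the (possibly indefinite) metric `g`: a smooth connection
on the tangent bundle that is torsion-free and satisfies `∇g = 0`. -/
structure IsLeviCivita
    (g : ∀ p : M, TangentSpace (𝓡 m) p →L[ℝ] TangentSpace (𝓡 m) p →L[ℝ] ℝ)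
    (nabla : CovariantDerivative (𝓡 m) (EuclideanSpace ℝ (Fin m))
      (TangentSpace (𝓡 m) : M → Type _)) : Prop where
  smooth : CovariantDerivative.ContMDiffCovariantDerivative nabla ∞
  torsion_free : nabla.torsion = 0
  metric : IsParallelTwoTensor nabla fun p x y => g p x y

/-- The covariant derivative `(∇_x J) y = ∇_x (J Y) - J (∇_x Y)` of a field of endomorphisms of the
tangent bundle, where `Y` is a local extension of `y`. (For differentiable `J` this does not depend
on the extension.) -/
def covDerivEndo
    (nabla : CovariantDerivative (𝓡 m) (EuclideanSpace ℝ (Fin m)) (TangentSpace (𝓡 m) : M → Type _))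
    (J : ∀ p : M, TangentSpace (𝓡 m) p →L[ℝ] TangentSpace (𝓡 m) p)
    (p : M) (x y : TangentSpace (𝓡 m) p) : TangentSpace (𝓡 m) p :=
  nabla (fun q => J q (extend (EuclideanSpace ℝ (Fin m)) y q)) p x
    - J p (nabla (extend (EuclideanSpace ℝ (Fin m)) y) p x)

/-- `R(X, Y) Z = ∇_X ∇_Y Z - ∇_Y ∇_X Z - ∇_{[X, Y]} Z` for vector fields. -/
def curvatureField
    (nabla : CovariantDerivative (𝓡 m) (EuclideanSpace ℝ (Fin m)) (TangentSpace (𝓡 m) : M → Type _))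
    (X Y Z : ∀ q : M, TangentSpace (𝓡 m) q) (p : M) : TangentSpace (𝓡 m) p :=
  nabla (fun q => nabla Z q (Y q)) p (X p) - nabla (fun q => nabla Z q (X q)) p (Y p)
    - nabla Z p (VectorField.mlieBracket (𝓡 m) X Y p)

/-- The curvature tensor `R(x, y) z` at `p`, computed from local extensions of `x`, `y`, `z` that
are smooth near `p`. (For smooth `∇` this does not depend on the extensions.) -/
def curvature
    (nabla : CovariantDerivative (𝓡 m) (EuclideanSpace ℝ (Fin m)) (TangentSpace (𝓡 m) : M → Type _))
    (p : M) (x y z : TangentSpace (𝓡 m) p) : TangentSpace (𝓡 m) p :=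
  curvatureField nabla (extend (EuclideanSpace ℝ (Fin m)) x)
    (extend (EuclideanSpace ℝ (Fin m)) y) (extend (EuclideanSpace ℝ (Fin m)) z) p

/-- The Ricci tensor `ρ(y, z) = g^{ij} R(e_i, y, z, e_j)`, where
`R(x, y, z, w) = g(R(x, y) z, w)`. -/
def ricci
    (g : ∀ p : M, TangentSpace (𝓡 m) p →L[ℝ] TangentSpace (𝓡 m) p →L[ℝ] ℝ)
    (nabla : CovariantDerivative (𝓡 m) (EuclideanSpace ℝ (Fin m)) (TangentSpace (𝓡 m) : M → Type _))
    (p : M) (y z : TangentSpace (𝓡 m) p) : ℝ :=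
  metricTrace (g p) fun x w => g p (curvature nabla p x y z) w

/-- The scalar curvature `τ = g^{ij} ρ(e_i, e_j)`. -/
def scalarCurvature
    (g : ∀ p : M, TangentSpace (𝓡 m) p →L[ℝ] TangentSpace (𝓡 m) p →L[ℝ] ℝ)
    (nabla : CovariantDerivative (𝓡 m) (EuclideanSpace ℝ (Fin m)) (TangentSpace (𝓡 m) : M → Type _))
    (p : M) : ℝ :=
  metricTrace (g p) (ricci g nabla p)

/-- A field of endomorphisms of the tangent bundle is smooth. -/
def SmoothEndo (J : ∀ p : M, TangentSpace (𝓡 m) p →L[ℝ] TangentSpace (𝓡 m) p) : Prop :=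
  ContMDiff (𝓡 m)
    ((𝓡 m).prod 𝓘(ℝ, EuclideanSpace ℝ (Fin m) →L[ℝ] EuclideanSpace ℝ (Fin m))) ∞
    (fun p => TotalSpace.mk' (EuclideanSpace ℝ (Fin m) →L[ℝ] EuclideanSpace ℝ (Fin m))
      (E := fun p : M => TangentSpace (𝓡 m) p →L[ℝ] TangentSpace (𝓡 m) p) p (J p))

/-- A family `om` of linear forms on the tangent spaces is a smooth 1-form on `U`. -/
def SmoothOneFormOn (om : ∀ p : M, TangentSpace (𝓡 m) p →L[ℝ] ℝ) (U : Set M) : Prop :=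
  ContMDiffOn (𝓡 m) ((𝓡 m).prod 𝓘(ℝ, EuclideanSpace ℝ (Fin m) →L[ℝ] ℝ)) ∞
    (fun p => TotalSpace.mk' (EuclideanSpace ℝ (Fin m) →L[ℝ] ℝ)
      (E := fun p : M => TangentSpace (𝓡 m) p →L[ℝ] ℝ) p (om p)) U

variable (m M) in
/-- An almost hypercomplex NH-structure on `M`: almost complex structures `J₁, J₂, J₃` with
`J_α = J_β J_γ = - J_γ J_β` for the cyclic permutations `(α, β, γ)` of `(1, 2, 3)`, and a
pseudo-Riemannian metric `g` that is Hermitian for `J₁` and Norden (anti-Hermitian) for `J₂` and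
`J₃`. The anti-isometry `J₂` forces `g` to have neutral signature. The associated tensors
`g_α(x, y) = g(J_α x, y)` are determined by these data. -/
structure AlmostHypercomplexNH where
  J₁ : ∀ p : M, TangentSpace (𝓡 m) p →L[ℝ] TangentSpace (𝓡 m) p
  J₂ : ∀ p : M, TangentSpace (𝓡 m) p →L[ℝ] TangentSpace (𝓡 m) p
  J₃ : ∀ p : M, TangentSpace (𝓡 m) p →L[ℝ] TangentSpace (𝓡 m) p
  g : ∀ p : M, TangentSpace (𝓡 m) p →L[ℝ] TangentSpace (𝓡 m) p →L[ℝ] ℝ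
  smooth_J₁ : SmoothEndo J₁
  smooth_J₂ : SmoothEndo J₂
  smooth_J₃ : SmoothEndo J₃
  smooth_g : ContMDiff (𝓡 m)
    ((𝓡 m).prod 𝓘(ℝ, EuclideanSpace ℝ (Fin m) →L[ℝ] EuclideanSpace ℝ (Fin m) →L[ℝ] ℝ)) ∞
    (fun p => TotalSpace.mk' (EuclideanSpace ℝ (Fin m) →L[ℝ] EuclideanSpace ℝ (Fin m) →L[ℝ] ℝ)
      (E := fun p : M => TangentSpace (𝓡 m) p →L[ℝ] TangentSpace (𝓡 m) p →L[ℝ] ℝ) p (g p))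
  sq₁ : ∀ p x, J₁ p (J₁ p x) = -x
  sq₂ : ∀ p x, J₂ p (J₂ p x) = -x
  sq₃ : ∀ p x, J₃ p (J₃ p x) = -x
  mul₂₃ : ∀ p x, J₂ p (J₃ p x) = J₁ p x
  mul₃₂ : ∀ p x, J₃ p (J₂ p x) = -J₁ p x
  mul₃₁ : ∀ p x, J₃ p (J₁ p x) = J₂ p x
  mul₁₃ : ∀ p x, J₁ p (J₃ p x) = -J₂ p x
  mul₁₂ : ∀ p x, J₁ p (J₂ p x) = J₃ p x
  mul₂₁ : ∀ p x, J₂ p (J₁ p x) = -J₃ p x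
  g_symm : ∀ p x y, g p x y = g p y x
  g_nondeg : ∀ p x, (∀ y, g p x y = 0) → x = 0
  g_J₁ : ∀ p x y, g p (J₁ p x) (J₁ p y) = g p x y
  g_J₂ : ∀ p x y, g p (J₂ p x) (J₂ p y) = -g p x y
  g_J₃ : ∀ p x y, g p (J₃ p x) (J₃ p y) = -g p x y

/-- The Lie 1-form `θ(z) = g^{ij} F(e_i, e_j, z)` of the structural tensor
`F(x, y, z) = g((∇_x J) y, z)`. -/
def lieForm
    (g : ∀ p : M, TangentSpace (𝓡 m) p →L[ℝ] TangentSpace (𝓡 m) p →L[ℝ] ℝ)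
    (nabla : CovariantDerivative (𝓡 m) (EuclideanSpace ℝ (Fin m)) (TangentSpace (𝓡 m) : M → Type _))
    (J : ∀ p : M, TangentSpace (𝓡 m) p →L[ℝ] TangentSpace (𝓡 m) p)
    (p : M) (z : TangentSpace (𝓡 m) p) : ℝ :=
  metricTrace (g p) fun x y => g p (covDerivEndo nabla J p x y) z

/-- The quaternionic Kähler condition: locally there are 1-forms `ω₁, ω₂, ω₃` with
`(∇_x J_α) y = ω_γ(x) J_β y - ω_β(x) J_γ y` for all cyclic permutations `(α, β, γ)` of
`(1, 2, 3)`. -/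
def IsQuaternionicKahler (S : AlmostHypercomplexNH m M)
    (nabla : CovariantDerivative (𝓡 m) (EuclideanSpace ℝ (Fin m))
      (TangentSpace (𝓡 m) : M → Type _)) : Prop :=
  ∀ p : M, ∃ U : Set M, IsOpen U ∧ p ∈ U ∧
    ∃ om₁ om₂ om₃ : ∀ q : M, TangentSpace (𝓡 m) q →L[ℝ] ℝ,
      SmoothOneFormOn om₁ U ∧ SmoothOneFormOn om₂ U ∧ SmoothOneFormOn om₃ U ∧
      ∀ q ∈ U, ∀ x y : TangentSpace (𝓡 m) q,
        covDerivEndo nabla S.J₁ q x y = om₃ q x • S.J₂ q y - om₂ q x • S.J₃ q y ∧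
        covDerivEndo nabla S.J₂ q x y = om₁ q x • S.J₃ q y - om₃ q x • S.J₁ q y ∧
        covDerivEndo nabla S.J₃ q x y = om₂ q x • S.J₁ q y - om₁ q x • S.J₂ q y

/-- The structure is determined by a local 1-form `ω₁` through `∇J₁ = 0`, `∇J₂ = ω₁ ⊗ J₃`,
`∇J₃ = -ω₁ ⊗ J₂`, where `ω₁ = -θ₂ ∘ J₃ = θ₃ ∘ J₂`. -/
def IsDeterminedByOneForm (S : AlmostHypercomplexNH m M)
    (nabla : CovariantDerivative (𝓡 m) (EuclideanSpace ℝ (Fin m))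
      (TangentSpace (𝓡 m) : M → Type _)) : Prop :=
  ∀ p : M, ∃ U : Set M, IsOpen U ∧ p ∈ U ∧
    ∃ om₁ : ∀ q : M, TangentSpace (𝓡 m) q →L[ℝ] ℝ, SmoothOneFormOn om₁ U ∧
      ∀ q ∈ U, ∀ x y : TangentSpace (𝓡 m) q,
        covDerivEndo nabla S.J₁ q x y = 0 ∧
        covDerivEndo nabla S.J₂ q x y = om₁ q x • S.J₃ q y ∧
        covDerivEndo nabla S.J₃ q x y = -(om₁ q x • S.J₂ q y) ∧
        om₁ q x = -lieForm S.g nabla S.J₂ q (S.J₃ q x) ∧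
        om₁ q x = lieForm S.g nabla S.J₃ q (S.J₂ q x)

end NHGeometry

end

/-!
The curvature is first computed with globally smooth vector fields. The first Bianchi identity
comes from the Jacobi identity, skewness from `[X, Y]f = X(Yf) - Y(Xf)`, and the pair symmetry from
both. By these symmetries every argument of `g(R(X, Y)Z, W)` can be moved to the last place, where
it enters only through its value at the point, linearly. So the curvature is a tensor, and no
Leibniz computation is needed (`curvatureField_eq_of_apply_eq`, `exists_linear_eq_curvature`).

Since `J₃ ≠ 0`, the local forms `ω₁` glue to a global 1-form `ω` (`exists_isConnectionForm`).
The equations for `∇J₁` and `∇J₂` give `[R(x, y), J₁] = 0` and `[R(x, y), J₂] = dω(x, y) J₃`. The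
rest of the pointwise argument is linear algebra (`IsNHCurvature`) in dimension `N = 4n`. Let
`Ω(x, y) = g(J₁x, y)`.

* Taking traces in the two commutation relations gives `4 ρ(x, J₁y) = N dω(x, y)`.
* Contracting the second relation makes `(N - 4) dω(y, J₃z)` symmetric in `y` and `z`; since
  `N > 4`, the form `dω` is invariant under `J₃`, hence under `J₂`.
* Adding to `g(R(x, y)z, w)` its value with `J₂` applied to `z` and `w` gives `dω(x, y) Ω(z, w)`.
  Symmetrizing both pairs in this way, and exchanging them by the pair symmetry, yields
  `dω(x, y) Ω(z, w) = dω(z, w) Ω(x, y)`.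

Consequently `ρ = k g` and `N dω = -4 k Ω` for a function `k`. Both `dω` and `Ω` are closed (`Ω` is
parallel), so `dk ∧ Ω = 0`, and contraction with `Ω` gives `dk = 0`. Thus `k` is locally constant,
`τ = N k` is locally constant, and `ρ = k g` is parallel together with `g`.
-/

noncomputable section

namespace NHGeometry

open VectorField Module

/-! ### Curvature-like tensors -/

/-- The exchange symmetry of the two pairs of arguments of a curvature tensor. Only the values at
four fixed arguments enter, so it applies to vector fields before any linearity is known. -/
theorem curvature_pair_symm {ι : Type*} {Q : ι → ι → ι → ι → ℝ}
    (h₁ : ∀ x y z w, Q x y z w = -Q y x z w) (h₂ : ∀ x y z w, Q x y z w = -Q x y w z)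
    (hb : ∀ x y z w, Q x y z w + Q y z x w + Q z x y w = 0) (x y z w : ι) :
    Q x y z w = Q z w x y := by
  have b₁ := hb x y z w
  have b₂ := hb y z w x
  have b₃ := hb z w x y
  have b₄ := hb w x y z
  have a₁ := h₂ z x y w
  have a₂ := h₂ y z w x
  have a₃ := h₁ z w y x
  have a₄ := h₂ w z y x
  have a₅ := h₁ w y z x
  have a₆ := h₂ y w z x
  have a₇ := h₂ w x z y
  have a₈ := h₁ x z w y
  have a₉ := h₂ x y w z
  have c₁ := h₂ w z x y
  have c₂ := h₁ w z x y
  have c₃ := h₂ y z x w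
  have c₄ := h₂ x y z w
  have c₅ := h₂ w x y z
  linarith

section LinearAlgebra

variable {V : Type*} [AddCommGroup V] [Module ℝ V]

theorem trace_eq_of_adjoint [FiniteDimensional ℝ V] {g : LinearMap.BilinForm ℝ V}
    (hg : g.Nondegenerate) {L L' : V →ₗ[ℝ] V} (h : ∀ x y, g (L x) y = g x (L' y)) :
    LinearMap.trace ℝ V L = LinearMap.trace ℝ V L' := by
  have : (g.toDual hg).conj L = Dual.transpose (R := ℝ) L' := by
    ext φ y
    obtain ⟨x, rfl⟩ := (g.toDual hg).surjective φ
    simp [LinearEquiv.conj_apply, LinearMap.BilinForm.toDual_def, h, Dual.transpose_apply]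
  rw [← LinearMap.trace_conj' L (g.toDual hg), this, LinearMap.trace_transpose']

/-- A map with the symmetries of a curvature tensor is linear in each argument, because each
argument of `g(R(x, y) z, w)` can be moved to the last place. -/
theorem exists_linear_eq_of_symmetries {g : LinearMap.BilinForm ℝ V}
    (hnd : ∀ x, (∀ y, g x y = 0) → x = 0) {R : V → V → V → V}
    (antisymm : ∀ x y z, R x y z = -R y x z) (skew : ∀ x y z w, g (R x y z) w = -g (R x y w) z)
    (pair : ∀ x y z w, g (R x y z) w = g (R z w x) y) :
    ∃ T : V →ₗ[ℝ] V →ₗ[ℝ] V →ₗ[ℝ] V, ∀ x y z, T x y z = R x y z := by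
  have ext_g {u v : V} (h : ∀ w, g u w = g v w) : u = v :=
    sub_eq_zero.mp (hnd _ fun w => by rw [map_sub, LinearMap.sub_apply, h, sub_self])
  have add₃ (x y z z' : V) : R x y (z + z') = R x y z + R x y z' := ext_g fun w => by
    simp [skew x y _ w]
    ring
  have smul₃ (c : ℝ) (x y z : V) : R x y (c • z) = c • R x y z := ext_g fun w => by
    simp [skew x y _ w]
  have add₁ (x x' y z : V) : R (x + x') y z = R x y z + R x' y z := ext_g fun w => by
    simp [pair _ y z w, add₃]
  have smul₁ (c : ℝ) (x y z : V) : R (c • x) y z = c • R x y z := ext_g fun w => by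
    simp [pair _ y z w, smul₃]
  refine ⟨LinearMap.mk₂ ℝ (fun x y => ⟨⟨R x y, add₃ x y⟩, fun c => smul₃ c x y⟩) ?_ ?_ ?_ ?_,
    fun x y z => rfl⟩
  · exact fun x x' y => LinearMap.ext fun z => add₁ x x' y z
  · exact fun c x y => LinearMap.ext fun z => smul₁ c x y z
  · refine fun x y y' => LinearMap.ext fun z => ?_
    change R x (y + y') z = R x y z + R x y' z
    rw [antisymm, add₁, neg_add, ← antisymm, ← antisymm]
  · refine fun c x y => LinearMap.ext fun z => ?_
    change R x (c • y) z = c • R x y z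
    rw [antisymm, smul₁, ← smul_neg, ← antisymm]

/-- The Ricci contraction `ρ(y, z) = tr (x ↦ R(x, y) z)`. -/
def ricciTrace (R : V →ₗ[ℝ] V →ₗ[ℝ] V →ₗ[ℝ] V) : V →ₗ[ℝ] V →ₗ[ℝ] ℝ :=
  (LinearMap.lflip.toLinearMap ∘ₗ R.flip).compr₂ (LinearMap.trace ℝ V)

theorem ricciTrace_apply (R : V →ₗ[ℝ] V →ₗ[ℝ] V →ₗ[ℝ] V) (y z : V) :
    ricciTrace R y z = LinearMap.trace ℝ V ((R.flip y).flip z) := rfl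

/-- The pointwise algebraic data of a metric connection without torsion on an almost hypercomplex
NH-manifold with `∇J₁ = 0` and `∇J₂ = ω ⊗ J₃`: here `σ` is the value of `dω` and `R` the
curvature. -/
structure IsNHCurvature (g : LinearMap.BilinForm ℝ V) (J₁ J₂ J₃ : V →ₗ[ℝ] V)
    (R : V →ₗ[ℝ] V →ₗ[ℝ] V →ₗ[ℝ] V) (σ : V → V → ℝ) : Prop where
  symm : ∀ x y, g x y = g y x
  nondeg : ∀ x, (∀ y, g x y = 0) → x = 0
  sq₁ : ∀ x, J₁ (J₁ x) = -x
  sq₂ : ∀ x, J₂ (J₂ x) = -x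
  sq₃ : ∀ x, J₃ (J₃ x) = -x
  mul₂₃ : ∀ x, J₂ (J₃ x) = J₁ x
  mul₃₂ : ∀ x, J₃ (J₂ x) = -J₁ x
  mul₃₁ : ∀ x, J₃ (J₁ x) = J₂ x
  mul₁₂ : ∀ x, J₁ (J₂ x) = J₃ x
  g_J₁ : ∀ x y, g (J₁ x) (J₁ y) = g x y
  g_J₂ : ∀ x y, g (J₂ x) (J₂ y) = -g x y
  antisymm : ∀ x y z, R x y z = -R y x z
  skew : ∀ x y z w, g (R x y z) w = -g (R x y w) z
  bianchi : ∀ x y z, R x y z + R y z x + R z x y = 0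
  comm₁ : ∀ x y z, R x y (J₁ z) = J₁ (R x y z)
  comm₂ : ∀ x y z, R x y (J₂ z) = J₂ (R x y z) + σ x y • J₃ z

namespace IsNHCurvature

variable {g : LinearMap.BilinForm ℝ V} {J₁ J₂ J₃ : V →ₗ[ℝ] V}
  {R : V →ₗ[ℝ] V →ₗ[ℝ] V →ₗ[ℝ] V} {σ : V → V → ℝ}

theorem nondegenerate (h : IsNHCurvature g J₁ J₂ J₃ R σ) : g.Nondegenerate :=
  ⟨h.nondeg, fun x hx => h.nondeg x fun y => by rw [h.symm, hx]⟩

theorem J₂_symm (h : IsNHCurvature g J₁ J₂ J₃ R σ) (x y : V) : g (J₂ x) y = g x (J₂ y) := by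
  have := h.g_J₂ x (J₂ y)
  rw [h.sq₂, map_neg] at this
  linarith

theorem pair (h : IsNHCurvature g J₁ J₂ J₃ R σ) (x y z w : V) :
    g (R x y z) w = g (R z w x) y := by
  refine curvature_pair_symm (Q := fun x y z w => g (R x y z) w) (fun x y z w => ?_) h.skew
    (fun x y z w => ?_) x y z w
  · rw [h.antisymm, map_neg, LinearMap.neg_apply]
  · have := congrArg (fun v => g v w) (h.bianchi x y z)
    simpa using this

theorem R_J₁_J₁ (h : IsNHCurvature g J₁ J₂ J₃ R σ) (x y z : V) : R (J₁ x) (J₁ y) z = R x y z := by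
  refine sub_eq_zero.mp (h.nondeg _ fun w => ?_)
  rw [map_sub, LinearMap.sub_apply, h.pair, h.pair x y, h.comm₁, h.g_J₁, sub_self]

theorem R_right_J₁ (h : IsNHCurvature g J₁ J₂ J₃ R σ) (x y z : V) :
    R x (J₁ y) z = -R (J₁ x) y z := by
  have := h.R_J₁_J₁ x (J₁ y) z
  rw [h.sq₁] at this
  simpa using this.symm

theorem ricciTrace_J₁_J₁ (h : IsNHCurvature g J₁ J₂ J₃ R σ) (y z : V) :
    ricciTrace R (J₁ y) (J₁ z) = ricciTrace R y z := by
  have e : (R.flip (J₁ y)).flip (J₁ z) = J₁ * (-((R.flip y).flip z) * J₁) := by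
    ext x
    change R x (J₁ y) (J₁ z) = J₁ (-(R (J₁ x) y z))
    rw [h.comm₁, h.R_right_J₁]
  have e' : -((R.flip y).flip z) * J₁ * J₁ = (R.flip y).flip z := by
    ext x
    change -(R (J₁ (J₁ x)) y z) = R x y z
    simp [h.sq₁]
  rw [ricciTrace_apply, e, LinearMap.trace_mul_comm, e', ricciTrace_apply]

theorem ricciTrace_J₁ (h : IsNHCurvature g J₁ J₂ J₃ R σ) (y z : V) :
    ricciTrace R (J₁ y) z = -ricciTrace R y (J₁ z) := by
  have := h.ricciTrace_J₁_J₁ y (J₁ z)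
  rw [h.sq₁, map_neg] at this
  linarith

/-- Symmetrizing the curvature tensor under `J₂` in the second pair of arguments leaves only the
part along `J₁`. -/
theorem R_add_R_J₂ (h : IsNHCurvature g J₁ J₂ J₃ R σ) (x y z w : V) :
    g (R x y z) w + g (R x y (J₂ z)) (J₂ w) = σ x y * g (J₁ z) w := by
  rw [h.comm₂, map_add, LinearMap.add_apply, h.g_J₂, map_smul, LinearMap.smul_apply, ← h.J₂_symm,
    h.mul₂₃, smul_eq_mul]
  ring

variable [FiniteDimensional ℝ V]

theorem ricciTrace_symm (h : IsNHCurvature g J₁ J₂ J₃ R σ) (y z : V) :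
    ricciTrace R y z = ricciTrace R z y := by
  refine trace_eq_of_adjoint h.nondegenerate fun x w => ?_
  change g (R x y z) w = g x (R w z y)
  rw [h.pair, h.antisymm, h.symm x, h.skew w, map_neg, LinearMap.neg_apply, h.skew w z x y]

/-- The Ricci form `tr (J₁ ∘ R(x, y))` of the Kähler structure `(g, J₁)`, by the Bianchi
identity. -/
theorem trace_J₁_mul_R (h : IsNHCurvature g J₁ J₂ J₃ R σ) (x y : V) :
    LinearMap.trace ℝ V (J₁ * R x y) = -2 * ricciTrace R x (J₁ y) := by
  have e : J₁ * R x y = (R.flip y).flip (J₁ x) - (R.flip x).flip (J₁ y) := by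
    ext z
    change J₁ (R x y z) = R z y (J₁ x) - R z x (J₁ y)
    rw [h.comm₁, h.comm₁, ← map_sub, h.antisymm z y x]
    congr 1
    rw [← sub_eq_zero, ← h.bianchi x y z]
    abel
  rw [e, map_sub, ← ricciTrace_apply, ← ricciTrace_apply, h.ricciTrace_symm y, h.ricciTrace_J₁]
  ring

/-- The commutator `[R(x, y), J₂] = σ(x, y) J₃` determines the Ricci form: conjugation by `J₂`
changes the sign of `J₁`, so only the part of `R(x, y)` along `J₁` contributes to
`tr (J₁ ∘ R(x, y))`. -/
theorem ricciTrace_right_J₁ (h : IsNHCurvature g J₁ J₂ J₃ R σ) (x y : V) :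
    4 * ricciTrace R x (J₁ y) = finrank ℝ V * σ x y := by
  have e : J₁ * R x y = J₂ * (R x y * J₃) - σ x y • LinearMap.id := by
    ext z
    change J₁ (R x y z) = J₂ (R x y (J₃ z)) - σ x y • z
    have := h.comm₂ x y (J₃ z)
    rw [h.mul₂₃, h.comm₁, h.sq₃] at this
    rw [this]
    module
  have e' : R x y * J₃ * J₂ = -(R x y * J₁) := by
    ext z
    change R x y (J₃ (J₂ z)) = -R x y (J₁ z)
    rw [h.mul₃₂, map_neg]
  have t := congrArg (LinearMap.trace ℝ V) e
  rw [map_sub, LinearMap.trace_mul_comm ℝ J₂, e', map_neg, LinearMap.trace_mul_comm ℝ (R x y),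
    map_smul, LinearMap.trace_id, h.trace_J₁_mul_R, smul_eq_mul] at t
  linarith

/-- Contracting `[R(x, y), J₂] z = σ(x, y) J₃ z`: since `J₂` is `g`-symmetric, the contraction of
`J₂ R(x, y) z` is symmetric in `y` and `z`. -/
theorem ricciTrace_right_J₂ (h : IsNHCurvature g J₁ J₂ J₃ R σ) (hV : 0 < finrank ℝ V) (y z : V) :
    ricciTrace R y (J₂ z) - σ (J₃ z) y = ricciTrace R z (J₂ y) - σ (J₃ y) z := by
  have hN : (finrank ℝ V : ℝ) ≠ 0 := by positivity
  have hσ (x y : V) : σ x y = 4 / finrank ℝ V * ricciTrace R x (J₁ y) := by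
    have := h.ricciTrace_right_J₁ x y
    field_simp
    linarith
  have key (y z : V) : ricciTrace R y (J₂ z) - σ (J₃ z) y =
      LinearMap.trace ℝ V (J₂ * ((R.flip y).flip z)) := by
    let φ : V →ₗ[ℝ] ℝ := (4 / finrank ℝ V : ℝ) • (ricciTrace R).flip (J₁ y)
    have hφ (x : V) : φ x = σ x y := by simp [φ, hσ]
    have e : (R.flip y).flip (J₂ z) = J₂ * ((R.flip y).flip z) + φ.smulRight (J₃ z) := by
      ext x
      change R x y (J₂ z) = J₂ (R x y z) + φ x • J₃ z
      rw [h.comm₂, hφ]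
    rw [ricciTrace_apply, e, map_add, LinearMap.trace_smulRight, hφ, add_sub_cancel_right]
  rw [key, key, LinearMap.trace_mul_comm]
  refine trace_eq_of_adjoint h.nondegenerate fun x w => ?_
  change g (R (J₂ x) y z) w = g x (J₂ (R w z y))
  rw [← h.J₂_symm, h.pair, h.antisymm, h.symm (J₂ x), h.skew w, map_neg, LinearMap.neg_apply,
    h.skew w z (J₂ x) y]

theorem σ_antisymm (h : IsNHCurvature g J₁ J₂ J₃ R σ) (hV : 0 < finrank ℝ V) (x y : V) :
    σ x y = -σ y x := by
  have hN : (finrank ℝ V : ℝ) ≠ 0 := by positivity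
  have h₁ := h.ricciTrace_right_J₁ x y
  have h₂ := h.ricciTrace_right_J₁ y x
  have h₃ := h.ricciTrace_J₁ y x
  rw [h.ricciTrace_symm] at h₃
  apply mul_left_cancel₀ hN
  linarith

/-- The contraction of the commutator with `J₂` makes `(N - 4) σ(y, J₃z)` symmetric, which is where
the dimension `N = 4` has to be excluded. -/
theorem σ_J₂_J₂ (h : IsNHCurvature g J₁ J₂ J₃ R σ) (hV : 4 < finrank ℝ V) (x y : V) :
    σ (J₂ x) (J₂ y) = σ x y := by
  have hV' : 0 < finrank ℝ V := by omega
  have hN : (4 : ℝ) < finrank ℝ V := by exact_mod_cast hV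
  have hN0 : (finrank ℝ V : ℝ) ≠ 0 := by positivity
  have ρσ (y z : V) : 4 * ricciTrace R y (J₂ z) = -(finrank ℝ V * σ y (J₃ z)) := by
    rw [← h.ricciTrace_right_J₁, ← h.mul₁₂, h.sq₁, map_neg]
    ring
  have s₃ (y z : V) : σ y (J₃ z) = σ z (J₃ y) := by
    have e := h.ricciTrace_right_J₂ hV' y z
    rw [h.σ_antisymm hV' (J₃ z), h.σ_antisymm hV' (J₃ y)] at e
    have e₁ := ρσ y z
    have e₂ := ρσ z y
    have : (finrank ℝ V - 4 : ℝ) * σ y (J₃ z) = (finrank ℝ V - 4 : ℝ) * σ z (J₃ y) := by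
      linarith
    exact mul_left_cancel₀ (by linarith) this
  have neg_right (x y : V) : σ x (-y) = -σ x y := by
    apply mul_left_cancel₀ hN0
    rw [mul_neg, ← h.ricciTrace_right_J₁, ← h.ricciTrace_right_J₁]
    simp
  have s₁ (x y : V) : σ (J₁ x) (J₁ y) = σ x y := by
    apply mul_left_cancel₀ hN0
    rw [← h.ricciTrace_right_J₁, ← h.ricciTrace_right_J₁, h.ricciTrace_J₁_J₁]
  have s₃₃ (x y : V) : σ (J₃ x) (J₃ y) = σ x y := by
    rw [s₃, h.sq₃, neg_right, h.σ_antisymm hV' y x, neg_neg]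
  rw [← h.mul₃₁, ← h.mul₃₁, s₃₃, s₁]

/-- Symmetrizing the curvature tensor under `J₂` in both pairs of arguments, and exchanging the
pairs, shows that `dω` is proportional to the fundamental form of `J₁`. -/
theorem σ_mul_fundamentalForm (h : IsNHCurvature g J₁ J₂ J₃ R σ) (hV : 4 < finrank ℝ V)
    (x y z w : V) : σ x y * g (J₁ z) w = σ z w * g (J₁ x) y := by
  have e₁ := h.R_add_R_J₂ x y z w
  have e₂ := h.R_add_R_J₂ (J₂ x) (J₂ y) z w
  have e₃ := h.R_add_R_J₂ z w x y
  have e₄ := h.R_add_R_J₂ (J₂ z) (J₂ w) x y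
  rw [h.σ_J₂_J₂ hV] at e₂ e₄
  rw [h.pair z w, h.pair z w] at e₃
  rw [h.pair (J₂ z) (J₂ w), h.pair (J₂ z) (J₂ w)] at e₄
  linarith

/-- In dimension greater than `4`, both the Ricci tensor and the form `dω` are determined by a
single scalar. -/
theorem exists_scalar (h : IsNHCurvature g J₁ J₂ J₃ R σ) (hV : 4 < finrank ℝ V) :
    ∃ k : ℝ, (∀ x y, ricciTrace R x y = k * g x y) ∧
      ∀ x y, finrank ℝ V * σ x y = -4 * (k * g (J₁ x) y) := by
  obtain ⟨z, hz⟩ : ∃ z : V, z ≠ 0 := by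
    have : Nontrivial V := nontrivial_of_finrank_pos (R := ℝ) (by omega)
    exact exists_ne 0
  obtain ⟨w, hw⟩ : ∃ w, g (J₁ z) w ≠ 0 := by
    by_contra! H
    have h0 := h.nondeg _ H
    have := h.sq₁ z
    rw [h0, map_zero] at this
    exact hz (neg_eq_zero.mp this.symm)
  have hσ (x y : V) : σ x y = σ z w / g (J₁ z) w * g (J₁ x) y := by
    have := h.σ_mul_fundamentalForm hV x y z w
    field_simp
    exact this
  refine ⟨-(finrank ℝ V / 4 * (σ z w / g (J₁ z) w)), fun x y => ?_, fun x y => ?_⟩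
  · have e := h.ricciTrace_right_J₁ x (J₁ y)
    rw [h.sq₁, map_neg, hσ x, h.g_J₁] at e
    linarith
  · rw [hσ x]
    ring

end IsNHCurvature

/-- If `φ ∧ Ω = 0` for the fundamental form `Ω(x, y) = g(Jx, y)` of a skew `g`-isometry `J`, then
`φ = 0` in dimension greater than `2`. -/
theorem eq_zero_of_wedge_fundamentalForm [FiniteDimensional ℝ V]
    {g : LinearMap.BilinForm ℝ V} (hg : g.Nondegenerate)
    {J : V →ₗ[ℝ] V} (hsymm : ∀ x y, g x y = g y x) (hJ : ∀ x y, g (J x) (J y) = g x y)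
    (hskew : ∀ x y, g (J x) y = -g x (J y)) (hV : 2 < finrank ℝ V) {φ : V →ₗ[ℝ] ℝ}
    (h : ∀ x y z, φ x * g (J y) z + φ y * g (J z) x + φ z * g (J x) y = 0) : φ = 0 := by
  obtain ⟨v, rfl⟩ := (g.toDual hg).surjective φ
  have hv (x : V) : g.toDual hg v x = g v x := rfl
  simp only [hv] at h
  have sq (x : V) : J (J x) = -x := by
    refine eq_neg_of_add_eq_zero_left (hg.1 _ fun w => ?_)
    rw [map_add, LinearMap.add_apply, hskew, hJ]
    ring
  ext x
  -- The identity `h x y (J w)`, with the argument `w` of `g` removed by nondegeneracy; its trace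
  -- over `y` is `(dim V - 2) φ x`.
  have e : g v x • LinearMap.id - ((g v).smulRight x + (g (J x)).smulRight (J v)) =
      (0 : V →ₗ[ℝ] V) := by
    ext y
    refine hg.1 _ fun w => ?_
    have := h x y (J w)
    rw [hJ, sq, hsymm (-w) x, map_neg] at this
    simp only [LinearMap.sub_apply, LinearMap.add_apply, LinearMap.smul_apply, LinearMap.id_apply,
      LinearMap.smulRight_apply, map_sub, map_add, map_smul, smul_eq_mul, hskew v w]
    linarith
  have t := congrArg (LinearMap.trace ℝ V) e
  rw [map_sub, map_add, map_smul, LinearMap.trace_id, LinearMap.trace_smulRight,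
    LinearMap.trace_smulRight, hJ, hsymm x v, map_zero, smul_eq_mul] at t
  have hN : (2 : ℝ) < finrank ℝ V := by exact_mod_cast hV
  have : g v x * (finrank ℝ V - 2 : ℝ) = 0 := by linarith
  exact (mul_eq_zero.mp this).resolve_right (by linarith)

end LinearAlgebra

variable {m : ℕ} {M : Type*} [TopologicalSpace M]
  [ChartedSpace (EuclideanSpace ℝ (Fin m)) M]

/-! ### Contractions -/

section Trace

/-- The bilinear form underlying a continuous bilinear form on a tangent space. -/
def toBilinForm {p : M} (g : TangentSpace (𝓡 m) p →L[ℝ] TangentSpace (𝓡 m) p →L[ℝ] ℝ) :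
    LinearMap.BilinForm ℝ (TangentSpace (𝓡 m) p) :=
  ContinuousLinearMap.coeLM ℝ ∘ₗ g.toLinearMap

@[simp]
theorem toBilinForm_apply {p : M}
    (g : TangentSpace (𝓡 m) p →L[ℝ] TangentSpace (𝓡 m) p →L[ℝ] ℝ) (x y : TangentSpace (𝓡 m) p) :
    toBilinForm g x y = g x y := rfl

instance (p : M) : FiniteDimensional ℝ (TangentSpace (𝓡 m) p) :=
  inferInstanceAs (FiniteDimensional ℝ (EuclideanSpace ℝ (Fin m)))

theorem finrank_tangentSpace (p : M) : finrank ℝ (TangentSpace (𝓡 m) p) = m :=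
  finrank_euclideanSpace_fin

theorem exists_tangentVector_ne_zero (hm : 0 < m) (p : M) : ∃ y : TangentSpace (𝓡 m) p, y ≠ 0 := by
  have : Nontrivial (TangentSpace (𝓡 m) p) :=
    nontrivial_of_finrank_pos (R := ℝ) (by rwa [finrank_tangentSpace])
  exact exists_ne 0

/-- The vectors `frameVec p i` as a basis. -/
def frameBasis (p : M) : Basis (Fin m) ℝ (TangentSpace (𝓡 m) p) :=
  (EuclideanSpace.basisFun (Fin m) ℝ).toBasis

theorem frameBasis_apply (p : M) (i : Fin m) : frameBasis p i = frameVec p i := by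
  have : (EuclideanSpace.basisFun (Fin m) ℝ).toBasis i = EuclideanSpace.single i (1 : ℝ) := by
    simp
  exact this

theorem metricTrace_eq_trace {p : M}
    {g : TangentSpace (𝓡 m) p →L[ℝ] TangentSpace (𝓡 m) p →L[ℝ] ℝ} (hsymm : ∀ x y, g x y = g y x)
    (hnd : ∀ x, (∀ y, g x y = 0) → x = 0)
    (L : TangentSpace (𝓡 m) p →ₗ[ℝ] TangentSpace (𝓡 m) p) :
    metricTrace g (fun x w => g (L x) w) = LinearMap.trace ℝ _ L := by
  have hB : (toBilinForm g).Nondegenerate :=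
    ⟨hnd, fun x hx => hnd x fun y => by rw [hsymm]; exact hx y⟩
  let b : Basis (Fin m) ℝ (TangentSpace (𝓡 m) p) := frameBasis p
  let G := LinearMap.BilinForm.toMatrix b (toBilinForm g)
  have hG : (Matrix.of fun k l : Fin m => g (frameVec p k) (frameVec p l)) = G := by
    ext k l
    simp [G, b, LinearMap.BilinForm.toMatrix_apply, frameBasis_apply]
  have hGt : G.transpose = G := by
    rw [← hG]
    ext k l
    simp [hsymm]
  have hdet : IsUnit G.det :=
    isUnit_iff_ne_zero.mpr ((LinearMap.BilinForm.nondegenerate_iff_det_ne_zero b).mp hB)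
  have hL (i j : Fin m) : g (L (frameVec p i)) (frameVec p j) =
      ((LinearMap.toMatrix b b L).transpose * G) i j := by
    conv_lhs => rw [← frameBasis_apply, ← (frameBasis p).sum_repr (L (frameBasis p i))]
    simp [Matrix.mul_apply, G, b, LinearMap.BilinForm.toMatrix_apply, LinearMap.toMatrix_apply,
      frameBasis_apply]
  have hinv (i j : Fin m) : G⁻¹ i j = G⁻¹ j i := by
    conv_lhs => rw [← hGt, ← Matrix.transpose_nonsing_inv, Matrix.transpose_apply]
  rw [LinearMap.trace_eq_matrix_trace ℝ b, ← Matrix.trace_transpose,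
    ← Matrix.mul_nonsing_inv_cancel_right G (LinearMap.toMatrix b b L).transpose hdet]
  simp only [metricTrace, hG, hL, Matrix.trace, Matrix.diag]
  refine Finset.sum_congr rfl fun i _ => ?_
  rw [Matrix.mul_apply]
  exact Finset.sum_congr rfl fun j _ => by rw [hinv, mul_comm]

theorem metricTrace_smul_self {p : M}
    {g : TangentSpace (𝓡 m) p →L[ℝ] TangentSpace (𝓡 m) p →L[ℝ] ℝ} (hsymm : ∀ x y, g x y = g y x)
    (hnd : ∀ x, (∀ y, g x y = 0) → x = 0) (k : ℝ) :
    metricTrace g (fun x w => k * g x w) = k * m := by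
  have := metricTrace_eq_trace hsymm hnd (k • LinearMap.id)
  rw [map_smul, LinearMap.trace_id, finrank_tangentSpace] at this
  simpa using this

end Trace

/-! ### Smooth vector fields -/

theorem mdiffAt_of_contMDiff {f : M → ℝ} (hf : ContMDiff (𝓡 m) 𝓘(ℝ, ℝ) ∞ f) (p : M) :
    MDifferentiableAt (𝓡 m) 𝓘(ℝ, ℝ) f p :=
  (hf p).mdifferentiableAt (by simp)

variable [IsManifold (𝓡 m) ∞ M]

/-- A (globally defined) vector field of class `C^∞`. -/
def SmoothField (X : ∀ p : M, TangentSpace (𝓡 m) p) : Prop :=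
  ContMDiff (𝓡 m) (𝓡 m).tangent ∞ (T% X)

section Basic

variable {X Y Z : ∀ p : M, TangentSpace (𝓡 m) p}

theorem SmoothField.mdiffAt (hX : SmoothField X) (p : M) :
    MDifferentiableAt (𝓡 m) (𝓡 m).tangent (T% X) p :=
  (hX p).mdifferentiableAt (by simp)

theorem SmoothField.add (hX : SmoothField X) (hY : SmoothField Y) : SmoothField (X + Y) :=
  ContMDiff.add_section hX hY

theorem SmoothField.smul {f : M → ℝ} (hf : ContMDiff (𝓡 m) 𝓘(ℝ, ℝ) ∞ f) (hX : SmoothField X) :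
    SmoothField (f • X) :=
  ContMDiff.smul_section hf hX

theorem SmoothField.neg (hX : SmoothField X) : SmoothField (-X) :=
  ContMDiff.neg_section hX

theorem SmoothField.mlieBracket (hX : SmoothField X) (hY : SmoothField Y) :
    SmoothField (mlieBracket (𝓡 m) X Y) := by
  have : IsManifold (𝓡 m) (((⊤ : ℕ∞) : WithTop ℕ∞) + 1) M := by
    simpa using (inferInstance : IsManifold (𝓡 m) ∞ M)
  have : IsManifold (𝓡 m) (minSmoothness ℝ 2) M := by
    simp only [minSmoothness_of_isRCLikeNormedField]
    infer_instance
  exact ContDiff.mlieBracket_vectorField (m := ⊤) (n := ⊤) hX hY (by simp)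

theorem exists_smoothField_eventuallyEq_extend [T2Space M] (p : M) (v : TangentSpace (𝓡 m) p) :
    ∃ X : ∀ q : M, TangentSpace (𝓡 m) q, SmoothField X ∧
      ∀ᶠ q in 𝓝 p, X q = extend (EuclideanSpace ℝ (Fin m)) v q := by
  have : ContMDiffVectorBundle ∞ (EuclideanSpace ℝ (Fin m)) (TangentSpace (𝓡 m) : M → Type _)
      (𝓡 m) := by
    have : IsManifold (𝓡 m) (((⊤ : ℕ∞) : WithTop ℕ∞) + 1) M := by
      simpa using (inferInstance : IsManifold (𝓡 m) ∞ M)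
    exact TangentBundle.contMDiffVectorBundle
  obtain ⟨s, hs, hsv⟩ := exists_contMDiffOn_extend (k := ∞) (𝓡 m) (EuclideanSpace ℝ (Fin m)) v
  obtain ⟨u, hus, hu, hpu⟩ := mem_nhds_iff.mp hs
  obtain ⟨f, -, hf⟩ := (SmoothBumpFunction.nhds_basis_tsupport (I := 𝓡 m) p).mem_iff.mp
    (hu.mem_nhds hpu)
  refine ⟨fun q => f q • extend (EuclideanSpace ℝ (Fin m)) v q, ?_, ?_⟩
  · exact ContMDiffOn.smul_section_of_tsupport f.contMDiff.contMDiffOn hu hf (hsv.mono hus)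
  · filter_upwards [f.eventuallyEq_one] with q hq
    simp [hq]

theorem exists_smoothField_apply [T2Space M] (p : M) (v : TangentSpace (𝓡 m) p) :
    ∃ X : ∀ q : M, TangentSpace (𝓡 m) q, SmoothField X ∧ X p = v := by
  obtain ⟨X, hX, h⟩ := exists_smoothField_eventuallyEq_extend p v
  exact ⟨X, hX, by simpa using h.self_of_nhds⟩

theorem contMDiff_mvfderiv {f : M → ℝ} (hf : ContMDiff (𝓡 m) 𝓘(ℝ, ℝ) ∞ f) (hX : SmoothField X) :
    ContMDiff (𝓡 m) 𝓘(ℝ, ℝ) ∞ fun q => mvfderiv (𝓡 m) f q (X q) := by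
  have h₁ : ContMDiff (𝓡 m).tangent 𝓘(ℝ, ℝ).tangent ∞ (tangentMap (𝓡 m) 𝓘(ℝ, ℝ) f) :=
    hf.contMDiff_tangentMap (by simp)
  have h₂ := (contMDiff_snd_tangentBundle_modelSpace ℝ 𝓘(ℝ, ℝ)).comp (h₁.comp hX)
  exact h₂

theorem SmoothField.jacobi (hX : SmoothField X) (hY : SmoothField Y) (hZ : SmoothField Z) :
    VectorField.mlieBracket (𝓡 m) X (VectorField.mlieBracket (𝓡 m) Y Z) =
      VectorField.mlieBracket (𝓡 m) (VectorField.mlieBracket (𝓡 m) X Y) Z +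
        VectorField.mlieBracket (𝓡 m) Y (VectorField.mlieBracket (𝓡 m) X Z) := by
  have : IsManifold (𝓡 m) (minSmoothness ℝ 3) M := by
    simp only [minSmoothness_of_isRCLikeNormedField]
    infer_instance
  have h2 : minSmoothness ℝ 2 ≤ (∞ : WithTop ℕ∞) := by
    simp only [minSmoothness_of_isRCLikeNormedField]
    exact WithTop.coe_le_coe.2 (le_top : (2 : ℕ∞) ≤ ⊤)
  exact leibniz_identity_mlieBracket (hX.of_le h2) (hY.of_le h2) (hZ.of_le h2)

/-- The derivation along `[X, Y]` is the commutator of the derivations along `X` and `Y`: expand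
the Jacobi identity for `X`, `Y` and `fZ`, where `Z` does not vanish at the given point. -/
theorem mvfderiv_mlieBracket [T2Space M] {f : M → ℝ} (hf : ContMDiff (𝓡 m) 𝓘(ℝ, ℝ) ∞ f)
    (hX : SmoothField X) (hY : SmoothField Y) (p : M) :
    mvfderiv (𝓡 m) f p (mlieBracket (𝓡 m) X Y p) =
      mvfderiv (𝓡 m) (fun q => mvfderiv (𝓡 m) f q (Y q)) p (X p) -
        mvfderiv (𝓡 m) (fun q => mvfderiv (𝓡 m) f q (X q)) p (Y p) := by
  rcases subsingleton_or_nontrivial (TangentSpace (𝓡 m) p) with hs | hn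
  · rw [Subsingleton.elim (mlieBracket (𝓡 m) X Y p) 0, Subsingleton.elim (X p) 0,
      Subsingleton.elim (Y p) 0]
    simp
  obtain ⟨v, hv⟩ := exists_ne (0 : TangentSpace (𝓡 m) p)
  obtain ⟨Z, hZ, rfl⟩ := exists_smoothField_apply p v
  have smul_right {W : ∀ q : M, TangentSpace (𝓡 m) q} {U : ∀ q : M, TangentSpace (𝓡 m) q}
      {h : M → ℝ} (hh : ContMDiff (𝓡 m) 𝓘(ℝ, ℝ) ∞ h) (hU : SmoothField U) :
      VectorField.mlieBracket (𝓡 m) W (h • U) =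
        (fun q => mvfderiv (𝓡 m) h q (W q)) • U + h • VectorField.mlieBracket (𝓡 m) W U := by
    ext1 q
    exact mlieBracket_smul_right (mdiffAt_of_contMDiff hh q) (hU.mdiffAt q)
  have add_right {W U U' : ∀ q : M, TangentSpace (𝓡 m) q} (hU : SmoothField U)
      (hU' : SmoothField U') : VectorField.mlieBracket (𝓡 m) W (U + U') =
        VectorField.mlieBracket (𝓡 m) W U + VectorField.mlieBracket (𝓡 m) W U' := by
    ext1 q
    exact mlieBracket_add_right (hU.mdiffAt q) (hU'.mdiffAt q)
  have fX := contMDiff_mvfderiv hf hX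
  have fY := contMDiff_mvfderiv hf hY
  have XZ := hX.mlieBracket hZ
  have YZ := hY.mlieBracket hZ
  have J := hX.jacobi hY (hZ.smul hf)
  have J' := hX.jacobi hY hZ
  rw [smul_right hf hZ, smul_right hf hZ, smul_right hf hZ,
    add_right (hZ.smul fY) (YZ.smul hf), add_right (hZ.smul fX) (XZ.smul hf),
    smul_right fY hZ, smul_right hf YZ, smul_right fX hZ, smul_right hf XZ, J'] at J
  have Jp := congrFun J p
  simp only [Pi.add_apply, Pi.smul_apply', smul_add] at Jp
  have : (mvfderiv (𝓡 m) f p (VectorField.mlieBracket (𝓡 m) X Y p) -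
      (mvfderiv (𝓡 m) (fun q => mvfderiv (𝓡 m) f q (Y q)) p (X p) -
        mvfderiv (𝓡 m) (fun q => mvfderiv (𝓡 m) f q (X q)) p (Y p))) • Z p = 0 := by
    rw [← sub_eq_zero] at Jp
    rw [← neg_eq_zero, ← Jp]
    module
  exact sub_eq_zero.mp ((smul_eq_zero.mp this).resolve_right hv)

end Basic

/-! ### Covariant derivatives of smooth vector fields -/

section Connection

variable {nabla : CovariantDerivative (𝓡 m) (EuclideanSpace ℝ (Fin m))
    (TangentSpace (𝓡 m) : M → Type _)}
  {X X' Y Y' Z Z' W : ∀ p : M, TangentSpace (𝓡 m) p}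

theorem SmoothField.covDeriv (hn : CovariantDerivative.ContMDiffCovariantDerivative nabla ∞)
    (hZ : SmoothField Z) (hX : SmoothField X) : SmoothField fun q => nabla Z q (X q) := by
  have h := hn.contMDiff.contMDiff (σ := Z) (by simpa using hZ.contMDiffOn)
  rw [contMDiffOn_univ] at h
  exact ContMDiff.clm_bundle_apply h hX

theorem nabla_add (hY : SmoothField Y) (hZ : SmoothField Z) (p : M) :
    nabla (Y + Z) p = nabla Y p + nabla Z p :=
  nabla.isCovariantDerivativeOnUniv.add (hY.mdiffAt p) (hZ.mdiffAt p)

theorem nabla_neg (hY : SmoothField Y) (p : M) : nabla (-Y) p = -nabla Y p := by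
  have := nabla.isCovariantDerivativeOnUniv.smul_const (-1) (hY.mdiffAt p)
  simpa using this

theorem nabla_sub (hY : SmoothField Y) (hZ : SmoothField Z) (p : M) :
    nabla (Y - Z) p = nabla Y p - nabla Z p := by
  rw [sub_eq_add_neg, nabla_add hY hZ.neg, nabla_neg hZ, sub_eq_add_neg]

theorem nabla_smul {f : M → ℝ} (hf : ContMDiff (𝓡 m) 𝓘(ℝ, ℝ) ∞ f) (hY : SmoothField Y) (p : M)
    (x : TangentSpace (𝓡 m) p) :
    nabla (f • Y) p x = f p • nabla Y p x + mvfderiv (𝓡 m) f p x • Y p := by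
  rw [nabla.isCovariantDerivativeOnUniv.leibniz (hY.mdiffAt p) (mdiffAt_of_contMDiff hf p)]
  rfl

theorem SmoothField.mdiffAt_congr (hY : SmoothField Y) {p : M} (h : ∀ᶠ q in 𝓝 p, Y' q = Y q) :
    MDifferentiableAt (𝓡 m) (𝓡 m).tangent (T% Y') p :=
  (hY.mdiffAt p).congr_of_eventuallyEq (h.mono fun q hq => by simp [hq])

theorem nabla_congr (hY : SmoothField Y) {p : M} (h : ∀ᶠ q in 𝓝 p, Y' q = Y q) :
    nabla Y' p = nabla Y p :=
  nabla.isCovariantDerivativeOnUniv.congr_of_eventuallyEq (hY.mdiffAt_congr h) (hY.mdiffAt p)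
    Filter.univ_mem h

theorem curvatureField_congr (hn : CovariantDerivative.ContMDiffCovariantDerivative nabla ∞)
    (hX : SmoothField X) (hY : SmoothField Y) (hZ : SmoothField Z) {p : M}
    (hX' : ∀ᶠ q in 𝓝 p, X' q = X q) (hY' : ∀ᶠ q in 𝓝 p, Y' q = Y q)
    (hZ' : ∀ᶠ q in 𝓝 p, Z' q = Z q) :
    curvatureField nabla X' Y' Z' p = curvatureField nabla X Y Z p := by
  have key {U U' : ∀ p : M, TangentSpace (𝓡 m) p} (hU : SmoothField U)
      (hU' : ∀ᶠ q in 𝓝 p, U' q = U q) :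
      nabla (fun q => nabla Z' q (U' q)) p = nabla (fun q => nabla Z q (U q)) p := by
    refine nabla_congr (hZ.covDeriv hn hU) ?_
    filter_upwards [hU', eventually_eventually_nhds.mpr hZ'] with q hq hq'
    rw [hq, nabla_congr hZ hq']
  have hb : mlieBracket (𝓡 m) X' Y' p = mlieBracket (𝓡 m) X Y p :=
    Filter.EventuallyEq.mlieBracket_vectorField_eq hX' hY'
  simp only [curvatureField, key hX hX', key hY hY', nabla_congr hZ hZ', hb, hX'.self_of_nhds,
    hY'.self_of_nhds]

theorem curvatureField_antisymm (p : M) :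
    curvatureField nabla X Y Z p = -curvatureField nabla Y X Z p := by
  simp only [curvatureField]
  rw [mlieBracket_swap_apply, map_neg]
  abel

end Connection

section LeviCivita

variable {g : ∀ p : M, TangentSpace (𝓡 m) p →L[ℝ] TangentSpace (𝓡 m) p →L[ℝ] ℝ}
  {nabla : CovariantDerivative (𝓡 m) (EuclideanSpace ℝ (Fin m))
    (TangentSpace (𝓡 m) : M → Type _)}
  {X X' Y Y' Z Z' W : ∀ p : M, TangentSpace (𝓡 m) p}

/-- The field of bilinear forms `g` is smooth. -/
def SmoothBilin (g : ∀ p : M, TangentSpace (𝓡 m) p →L[ℝ] TangentSpace (𝓡 m) p →L[ℝ] ℝ) : Prop :=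
  ContMDiff (𝓡 m)
    ((𝓡 m).prod 𝓘(ℝ, EuclideanSpace ℝ (Fin m) →L[ℝ] EuclideanSpace ℝ (Fin m) →L[ℝ] ℝ)) ∞
    (fun p => TotalSpace.mk' (EuclideanSpace ℝ (Fin m) →L[ℝ] EuclideanSpace ℝ (Fin m) →L[ℝ] ℝ)
      (E := fun p : M => TangentSpace (𝓡 m) p →L[ℝ] TangentSpace (𝓡 m) p →L[ℝ] ℝ) p (g p))

theorem SmoothBilin.contMDiff_apply (hg : SmoothBilin g) (hX : SmoothField X)
    (hY : SmoothField Y) : ContMDiff (𝓡 m) 𝓘(ℝ, ℝ) ∞ fun q => g q (X q) (Y q) := by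
  have h : ContMDiff (𝓡 m) ((𝓡 m).prod 𝓘(ℝ, ℝ)) ∞
      (fun q => TotalSpace.mk' ℝ (E := Bundle.Trivial M ℝ) q (g q (X q) (Y q))) :=
    ContMDiff.clm_bundle_apply₂ (F₁ := EuclideanSpace ℝ (Fin m))
      (F₂ := EuclideanSpace ℝ (Fin m)) hg hX hY
  intro q
  have := h q
  simp only [contMDiffAt_totalSpace] at this
  exact this.2

theorem IsLeviCivita.nabla_sub_nabla (hLC : IsLeviCivita g nabla) (hX : SmoothField X)
    (hY : SmoothField Y) (p : M) :
    nabla Y p (X p) - nabla X p (Y p) = mlieBracket (𝓡 m) X Y p :=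
  nabla.torsion_eq_zero_iff.mp hLC.torsion_free (hX.mdiffAt p) (hY.mdiffAt p)

theorem IsLeviCivita.mvfderiv_metric (hLC : IsLeviCivita g nabla) (hY : SmoothField Y)
    (hZ : SmoothField Z) (p : M) (x : TangentSpace (𝓡 m) p) :
    mvfderiv (𝓡 m) (fun q => g q (Y q) (Z q)) p x =
      g p (nabla Y p x) (Z p) + g p (Y p) (nabla Z p x) :=
  (hLC.metric p Y Z (hY.mdiffAt p) (hZ.mdiffAt p)).2 x

theorem curvatureField_bianchi (hLC : IsLeviCivita g nabla) (hX : SmoothField X)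
    (hY : SmoothField Y) (hZ : SmoothField Z) (p : M) :
    curvatureField nabla X Y Z p + curvatureField nabla Y Z X p + curvatureField nabla Z X Y p =
      0 := by
  have key {A B C : ∀ p : M, TangentSpace (𝓡 m) p} (hA : SmoothField A) (hB : SmoothField B)
      (hC : SmoothField C) :
      nabla (fun q => nabla C q (B q)) p (A p) - nabla (fun q => nabla B q (C q)) p (A p) -
        nabla A p (mlieBracket (𝓡 m) B C p) =
      mlieBracket (𝓡 m) A (mlieBracket (𝓡 m) B C) p := by
    rw [← hLC.nabla_sub_nabla hA (hB.mlieBracket hC),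
      show mlieBracket (𝓡 m) B C = (fun q => nabla C q (B q)) - fun q => nabla B q (C q) from
        funext fun q => (hLC.nabla_sub_nabla hB hC q).symm,
      nabla_sub (hC.covDeriv hLC.smooth hB) (hB.covDeriv hLC.smooth hC)]
    rfl
  have k₁ := key hX hY hZ
  have k₂ := key hY hZ hX
  have k₃ := key hZ hX hY
  have j := congrFun (hX.jacobi hY hZ) p
  rw [mlieBracket_swap (V := mlieBracket (𝓡 m) X Y), mlieBracket_swap (V := X) (W := Z)] at j
  have e : mlieBracket (𝓡 m) Y (-mlieBracket (𝓡 m) Z X) p =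
      -mlieBracket (𝓡 m) Y (mlieBracket (𝓡 m) Z X) p := by
    have := mlieBracket_const_smul_right (V := Y) (c := (-1 : ℝ)) ((hZ.mlieBracket hX).mdiffAt p)
    simpa using this
  rw [Pi.add_apply, Pi.neg_apply, e, ← k₁, ← k₂, ← k₃, ← sub_eq_zero] at j
  simp only [curvatureField]
  rw [← j]
  abel

/-- The curvature of a metric connection is skew: `[X, Y] g(Z, W)` is the commutator of the
derivations along `X` and `Y`. -/
theorem curvatureField_skew [T2Space M] (hLC : IsLeviCivita g nabla) (hg : SmoothBilin g)
    (hX : SmoothField X) (hY : SmoothField Y) (hZ : SmoothField Z) (hW : SmoothField W) (p : M) :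
    g p (curvatureField nabla X Y Z p) (W p) = -g p (Z p) (curvatureField nabla X Y W p) := by
  have second {A B : ∀ p : M, TangentSpace (𝓡 m) p} (hA : SmoothField A) (hB : SmoothField B) :
      mvfderiv (𝓡 m) (fun q => mvfderiv (𝓡 m) (fun q => g q (Z q) (W q)) q (B q)) p (A p) =
        g p (nabla (fun q => nabla Z q (B q)) p (A p)) (W p) +
          g p (nabla Z p (B p)) (nabla W p (A p)) +
        (g p (nabla Z p (A p)) (nabla W p (B p)) +
          g p (Z p) (nabla (fun q => nabla W q (B q)) p (A p))) := by
    have hZB := hZ.covDeriv hLC.smooth hB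
    have hWB := hW.covDeriv hLC.smooth hB
    rw [show (fun q => mvfderiv (𝓡 m) (fun q => g q (Z q) (W q)) q (B q)) = fun q =>
        g q (nabla Z q (B q)) (W q) + g q (Z q) (nabla W q (B q)) from
        funext fun q => hLC.mvfderiv_metric hZ hW q (B q),
      mvfderiv_fun_add (mdiffAt_of_contMDiff (hg.contMDiff_apply hZB hW) p)
        (mdiffAt_of_contMDiff (hg.contMDiff_apply hZ hWB) p), add_apply,
      hLC.mvfderiv_metric hZB hW, hLC.mvfderiv_metric hZ hWB]
  have c := mvfderiv_mlieBracket (hg.contMDiff_apply hZ hW) hX hY p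
  rw [second hX hY, second hY hX, hLC.mvfderiv_metric hZ hW] at c
  simp only [curvatureField, map_sub, sub_apply]
  linarith

theorem curvatureField_pair [T2Space M] (hLC : IsLeviCivita g nabla) (hg : SmoothBilin g)
    (hsymm : ∀ p x y, g p x y = g p y x)
    (hX : SmoothField X) (hY : SmoothField Y) (hZ : SmoothField Z) (hW : SmoothField W) (p : M) :
    g p (curvatureField nabla X Y Z p) (W p) = g p (curvatureField nabla Z W X p) (Y p) := by
  refine curvature_pair_symm (ι := {X : ∀ p : M, TangentSpace (𝓡 m) p // SmoothField X})
    (Q := fun X Y Z W => g p (curvatureField nabla X.1 Y.1 Z.1 p) (W.1 p))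
    (fun X Y Z W => ?_) (fun X Y Z W => ?_) (fun X Y Z W => ?_) ⟨X, hX⟩ ⟨Y, hY⟩ ⟨Z, hZ⟩ ⟨W, hW⟩
  · rw [curvatureField_antisymm, map_neg, neg_apply]
  · rw [curvatureField_skew hLC hg X.2 Y.2 Z.2 W.2, hsymm]
  · have := congrArg (fun v => g p v (W.1 p)) (curvatureField_bianchi hLC X.2 Y.2 Z.2 p)
    simpa using this

/-- The curvature of smooth vector fields at `p` depends only on their values at `p`. With the
pair symmetry and skewness, each argument of `g(R(X, Y)Z, W)` can be moved to the last place. -/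
theorem curvatureField_eq_of_apply_eq [T2Space M] (hLC : IsLeviCivita g nabla)
    (hg : SmoothBilin g) (hsymm : ∀ p x y, g p x y = g p y x)
    (hnd : ∀ p x, (∀ y, g p x y = 0) → x = 0)
    (hX : SmoothField X) (hY : SmoothField Y) (hZ : SmoothField Z) (hX' : SmoothField X')
    (hY' : SmoothField Y') (hZ' : SmoothField Z') {p : M} (eX : X p = X' p) (eY : Y p = Y' p)
    (eZ : Z p = Z' p) : curvatureField nabla X Y Z p = curvatureField nabla X' Y' Z' p := by
  refine sub_eq_zero.mp (hnd p _ fun w => ?_)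
  obtain ⟨W, hW, rfl⟩ := exists_smoothField_apply p w
  have e₁ : g p (curvatureField nabla X Y Z p) (W p) = g p (curvatureField nabla X Y Z' p) (W p) :=
    by rw [curvatureField_skew hLC hg hX hY hZ hW, curvatureField_skew hLC hg hX hY hZ' hW, eZ]
  have e₂ : g p (curvatureField nabla X Y Z' p) (W p) =
      g p (curvatureField nabla X Y' Z' p) (W p) := by
    rw [curvatureField_pair hLC hg hsymm hX hY hZ' hW,
      curvatureField_pair hLC hg hsymm hX hY' hZ' hW, eY]
  have e₃ : g p (curvatureField nabla X Y' Z' p) (W p) =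
      g p (curvatureField nabla X' Y' Z' p) (W p) := by
    rw [curvatureField_antisymm, curvatureField_antisymm (X := X'), map_neg, map_neg,
      neg_apply, neg_apply,
      curvatureField_pair hLC hg hsymm hY' hX hZ' hW,
      curvatureField_pair hLC hg hsymm hY' hX' hZ' hW, eX]
  rw [map_sub, sub_apply, e₁, e₂, e₃, sub_self]

theorem curvature_eq_curvatureField [T2Space M] (hLC : IsLeviCivita g nabla)
    (hg : SmoothBilin g) (hsymm : ∀ p x y, g p x y = g p y x)
    (hnd : ∀ p x, (∀ y, g p x y = 0) → x = 0)
    (hX : SmoothField X) (hY : SmoothField Y) (hZ : SmoothField Z) (p : M) :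
    curvature nabla p (X p) (Y p) (Z p) = curvatureField nabla X Y Z p := by
  obtain ⟨X', hX', eX⟩ := exists_smoothField_eventuallyEq_extend p (X p)
  obtain ⟨Y', hY', eY⟩ := exists_smoothField_eventuallyEq_extend p (Y p)
  obtain ⟨Z', hZ', eZ⟩ := exists_smoothField_eventuallyEq_extend p (Z p)
  rw [curvature, curvatureField_congr hLC.smooth hX' hY' hZ' (eX.mono fun _ h => h.symm)
    (eY.mono fun _ h => h.symm) (eZ.mono fun _ h => h.symm)]
  refine curvatureField_eq_of_apply_eq hLC hg hsymm hnd hX' hY' hZ' hX hY hZ ?_ ?_ ?_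
  · simpa using eX.self_of_nhds
  · simpa using eY.self_of_nhds
  · simpa using eZ.self_of_nhds

end LeviCivita

/-! ### The curvature tensor at a point -/

section Curvature

variable {g : ∀ p : M, TangentSpace (𝓡 m) p →L[ℝ] TangentSpace (𝓡 m) p →L[ℝ] ℝ}
  {nabla : CovariantDerivative (𝓡 m) (EuclideanSpace ℝ (Fin m))
    (TangentSpace (𝓡 m) : M → Type _)}

theorem curvature_antisymm (p : M) (x y z : TangentSpace (𝓡 m) p) :
    curvature nabla p x y z = -curvature nabla p y x z :=
  curvatureField_antisymm p

theorem ricci_eq_ricciTrace {p : M} (hsymm : ∀ x y, g p x y = g p y x)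
    (hnd : ∀ x, (∀ y, g p x y = 0) → x = 0)
    {R : TangentSpace (𝓡 m) p →ₗ[ℝ] TangentSpace (𝓡 m) p →ₗ[ℝ] TangentSpace (𝓡 m) p →ₗ[ℝ]
      TangentSpace (𝓡 m) p} (hR : ∀ x y z, R x y z = curvature nabla p x y z)
    (y z : TangentSpace (𝓡 m) p) : ricci g nabla p y z = ricciTrace R y z := by
  rw [ricciTrace_apply, ← metricTrace_eq_trace hsymm hnd]
  simp only [ricci, LinearMap.flip_apply, hR]

variable [T2Space M]

theorem curvature_bianchi (hLC : IsLeviCivita g nabla) (hg : SmoothBilin g)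
    (hsymm : ∀ p x y, g p x y = g p y x) (hnd : ∀ p x, (∀ y, g p x y = 0) → x = 0)
    (p : M) (x y z : TangentSpace (𝓡 m) p) :
    curvature nabla p x y z + curvature nabla p y z x + curvature nabla p z x y = 0 := by
  obtain ⟨X, hX, rfl⟩ := exists_smoothField_apply p x
  obtain ⟨Y, hY, rfl⟩ := exists_smoothField_apply p y
  obtain ⟨Z, hZ, rfl⟩ := exists_smoothField_apply p z
  rw [curvature_eq_curvatureField hLC hg hsymm hnd hX hY hZ,
    curvature_eq_curvatureField hLC hg hsymm hnd hY hZ hX,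
    curvature_eq_curvatureField hLC hg hsymm hnd hZ hX hY, curvatureField_bianchi hLC hX hY hZ]

theorem curvature_skew (hLC : IsLeviCivita g nabla) (hg : SmoothBilin g)
    (hsymm : ∀ p x y, g p x y = g p y x) (hnd : ∀ p x, (∀ y, g p x y = 0) → x = 0)
    (p : M) (x y z w : TangentSpace (𝓡 m) p) :
    g p (curvature nabla p x y z) w = -g p (curvature nabla p x y w) z := by
  obtain ⟨X, hX, rfl⟩ := exists_smoothField_apply p x
  obtain ⟨Y, hY, rfl⟩ := exists_smoothField_apply p y
  obtain ⟨Z, hZ, rfl⟩ := exists_smoothField_apply p z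
  obtain ⟨W, hW, rfl⟩ := exists_smoothField_apply p w
  rw [curvature_eq_curvatureField hLC hg hsymm hnd hX hY hZ,
    curvature_eq_curvatureField hLC hg hsymm hnd hX hY hW,
    curvatureField_skew hLC hg hX hY hZ hW, hsymm]

theorem exists_linear_eq_curvature (hLC : IsLeviCivita g nabla) (hg : SmoothBilin g)
    (hsymm : ∀ p x y, g p x y = g p y x) (hnd : ∀ p x, (∀ y, g p x y = 0) → x = 0) (p : M) :
    ∃ R : TangentSpace (𝓡 m) p →ₗ[ℝ] TangentSpace (𝓡 m) p →ₗ[ℝ] TangentSpace (𝓡 m) p →ₗ[ℝ]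
      TangentSpace (𝓡 m) p, ∀ x y z, R x y z = curvature nabla p x y z := by
  have skew := curvature_skew hLC hg hsymm hnd p
  refine exists_linear_eq_of_symmetries (g := toBilinForm (g p)) (hnd p) (curvature_antisymm p)
    skew (curvature_pair_symm (Q := fun x y z w => g p (curvature nabla p x y z) w)
      (fun x y z w => ?_) skew fun x y z w => ?_)
  · rw [curvature_antisymm, map_neg, neg_apply]
  · have := congrArg (fun v => g p v w) (curvature_bianchi hLC hg hsymm hnd p x y z)
    simpa using this

end Curvature

/-! ### Parallel endomorphisms and connection forms -/

section Endomorphisms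

variable {nabla : CovariantDerivative (𝓡 m) (EuclideanSpace ℝ (Fin m))
    (TangentSpace (𝓡 m) : M → Type _)}
  {J : ∀ p : M, TangentSpace (𝓡 m) p →L[ℝ] TangentSpace (𝓡 m) p}
  {om : ∀ p : M, TangentSpace (𝓡 m) p →L[ℝ] ℝ}
  {X Y Z : ∀ p : M, TangentSpace (𝓡 m) p}

theorem SmoothEndo.smoothField (hJ : SmoothEndo J) (hY : SmoothField Y) :
    SmoothField fun q => J q (Y q) :=
  ContMDiff.clm_bundle_apply hJ hY

theorem SmoothEndo.mdiffAt (hJ : SmoothEndo J) {p : M}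
    (hY : MDifferentiableAt (𝓡 m) (𝓡 m).tangent (T% Y) p) :
    MDifferentiableAt (𝓡 m) (𝓡 m).tangent (T% fun q => J q (Y q)) p :=
  MDifferentiableAt.clm_bundle_apply ((hJ p).mdifferentiableAt (by simp)) hY

/-- `(∇_x J) y` does not depend on the extension of `y`. -/
theorem covDerivEndo_apply (hJ : SmoothEndo J) (hY : SmoothField Y) (p : M)
    (x : TangentSpace (𝓡 m) p) :
    covDerivEndo nabla J p x (Y p) = nabla (fun q => J q (Y q)) p x - J p (nabla Y p x) := by
  have hT : TensorialAt (𝓡 m) (EuclideanSpace ℝ (Fin m))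
      (fun Y : ∀ q : M, TangentSpace (𝓡 m) q =>
        nabla (fun q => J q (Y q)) p x - J p (nabla Y p x)) p := by
    constructor
    · intro f σ hf hσ
      have e : (fun q => J q ((f • σ) q)) = f • fun q => J q (σ q) := by
        ext1 q
        simp
      rw [e, nabla.isCovariantDerivativeOnUniv.leibniz (hJ.mdiffAt hσ) hf,
        nabla.isCovariantDerivativeOnUniv.leibniz hσ hf]
      simp
      module
    · intro σ σ' hσ hσ'
      have e : (fun q => J q ((σ + σ') q)) = (fun q => J q (σ q)) + fun q => J q (σ' q) := by
        ext1 q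
        simp
      rw [e, nabla.isCovariantDerivativeOnUniv.add (hJ.mdiffAt hσ) (hJ.mdiffAt hσ'),
        nabla.isCovariantDerivativeOnUniv.add hσ hσ']
      simp
      module
  exact hT.pointwise (mdifferentiableAt_extend ..) (hY.mdiffAt p) (by simp)

theorem nabla_endo (hJ : SmoothEndo J) (hY : SmoothField Y) (p : M) (x : TangentSpace (𝓡 m) p) :
    nabla (fun q => J q (Y q)) p x = J p (nabla Y p x) + covDerivEndo nabla J p x (Y p) := by
  rw [covDerivEndo_apply hJ hY]
  abel

theorem SmoothOneFormOn.contMDiff_apply (hom : SmoothOneFormOn om Set.univ)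
    (hX : SmoothField X) : ContMDiff (𝓡 m) 𝓘(ℝ, ℝ) ∞ fun q => om q (X q) := by
  have hom' := contMDiffOn_univ.mp hom
  have h : ContMDiff (𝓡 m) ((𝓡 m).prod 𝓘(ℝ, ℝ)) ∞
      (fun q => TotalSpace.mk' ℝ (E := Bundle.Trivial M ℝ) q (om q (X q))) :=
    ContMDiff.clm_bundle_apply (F₁ := EuclideanSpace ℝ (Fin m)) hom' hX
  intro q
  have := h q
  simp only [contMDiffAt_totalSpace] at this
  exact this.2

/-- The exterior derivative `dω(X, Y) = X ω(Y) - Y ω(X) - ω([X, Y])` of a 1-form, evaluated on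
vector fields. -/
def extDerivField (om : ∀ p : M, TangentSpace (𝓡 m) p →L[ℝ] ℝ)
    (X Y : ∀ p : M, TangentSpace (𝓡 m) p) (p : M) : ℝ :=
  mvfderiv (𝓡 m) (fun q => om q (Y q)) p (X p) - mvfderiv (𝓡 m) (fun q => om q (X q)) p (Y p) -
    om p (mlieBracket (𝓡 m) X Y p)

theorem contMDiff_extDerivField (hom : SmoothOneFormOn om Set.univ) (hX : SmoothField X)
    (hY : SmoothField Y) : ContMDiff (𝓡 m) 𝓘(ℝ, ℝ) ∞ (extDerivField om X Y) :=
  ((contMDiff_mvfderiv (hom.contMDiff_apply hY) hX).sub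
    (contMDiff_mvfderiv (hom.contMDiff_apply hX) hY)).sub
    (hom.contMDiff_apply (hX.mlieBracket hY))

/-- `d(dω) = 0`. -/
theorem extDerivField_closed [T2Space M] (hom : SmoothOneFormOn om Set.univ) (hX : SmoothField X)
    (hY : SmoothField Y) (hZ : SmoothField Z) (p : M) :
    mvfderiv (𝓡 m) (extDerivField om Y Z) p (X p) + mvfderiv (𝓡 m) (extDerivField om Z X) p (Y p) +
        mvfderiv (𝓡 m) (extDerivField om X Y) p (Z p) =
      extDerivField om (mlieBracket (𝓡 m) X Y) Z p + extDerivField om (mlieBracket (𝓡 m) Y Z) X p +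
        extDerivField om (mlieBracket (𝓡 m) Z X) Y p := by
  have expand {A B C : ∀ p : M, TangentSpace (𝓡 m) p} (hB : SmoothField B)
      (hC : SmoothField C) : mvfderiv (𝓡 m) (extDerivField om B C) p (A p) =
        mvfderiv (𝓡 m) (fun q => mvfderiv (𝓡 m) (fun q => om q (C q)) q (B q)) p (A p) -
        mvfderiv (𝓡 m) (fun q => mvfderiv (𝓡 m) (fun q => om q (B q)) q (C q)) p (A p) -
        mvfderiv (𝓡 m) (fun q => om q (mlieBracket (𝓡 m) B C q)) p (A p) := by
    have c₁ := contMDiff_mvfderiv (hom.contMDiff_apply hC) hB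
    have c₂ := contMDiff_mvfderiv (hom.contMDiff_apply hB) hC
    have c₃ := hom.contMDiff_apply (hB.mlieBracket hC)
    unfold extDerivField
    rw [mvfderiv_fun_sub (mdiffAt_of_contMDiff (c₁.sub c₂) p) (mdiffAt_of_contMDiff c₃ p),
      mvfderiv_fun_sub (mdiffAt_of_contMDiff c₁ p) (mdiffAt_of_contMDiff c₂ p), sub_apply,
      sub_apply]
  have jac : om p (mlieBracket (𝓡 m) (mlieBracket (𝓡 m) X Y) Z p) +
      om p (mlieBracket (𝓡 m) (mlieBracket (𝓡 m) Y Z) X p) +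
      om p (mlieBracket (𝓡 m) (mlieBracket (𝓡 m) Z X) Y p) = 0 := by
    have j := congrArg (om p) (congrFun (hX.jacobi hY hZ) p)
    have e : mlieBracket (𝓡 m) Y (mlieBracket (𝓡 m) X Z) p =
        mlieBracket (𝓡 m) (mlieBracket (𝓡 m) Z X) Y p := by
      rw [mlieBracket_swap (V := X) (W := Z), mlieBracket_swap_apply]
      have := mlieBracket_const_smul_left (W := Y) (c := (-1 : ℝ))
        ((hZ.mlieBracket hX).mdiffAt p)
      have h' : mlieBracket (𝓡 m) (-mlieBracket (𝓡 m) Z X) Y p =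
        -mlieBracket (𝓡 m) (mlieBracket (𝓡 m) Z X) Y p := by simpa using this
      rw [h', neg_neg]
    rw [mlieBracket_swap_apply, Pi.add_apply, e, map_neg, map_add] at j
    linarith
  have cX := mvfderiv_mlieBracket (hom.contMDiff_apply hX) hY hZ p
  have cY := mvfderiv_mlieBracket (hom.contMDiff_apply hY) hZ hX p
  have cZ := mvfderiv_mlieBracket (hom.contMDiff_apply hZ) hX hY p
  rw [expand hY hZ, expand hZ hX, expand hX hY]
  simp only [extDerivField, cX, cY, cZ]
  linarith

end Endomorphisms

/-! ### The curvature of the NH-structure -/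

section Structure

variable {S : AlmostHypercomplexNH m M}
  {nabla : CovariantDerivative (𝓡 m) (EuclideanSpace ℝ (Fin m))
    (TangentSpace (𝓡 m) : M → Type _)}
  {om : ∀ p : M, TangentSpace (𝓡 m) p →L[ℝ] ℝ}
  {X Y Z : ∀ p : M, TangentSpace (𝓡 m) p}

theorem AlmostHypercomplexNH.smoothBilin (S : AlmostHypercomplexNH m M) : SmoothBilin S.g :=
  S.smooth_g

theorem AlmostHypercomplexNH.J₃_ne_zero (S : AlmostHypercomplexNH m M) {p : M}
    {y : TangentSpace (𝓡 m) p} (hy : y ≠ 0) : S.J₃ p y ≠ 0 := fun h => by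
  have := S.sq₃ p y
  rw [h, map_zero] at this
  exact hy (neg_eq_zero.mp this.symm)

/-- `ω` is the connection form of the structure: `∇J₁ = 0`, `∇J₂ = ω ⊗ J₃`, `∇J₃ = -ω ⊗ J₂`. -/
structure IsConnectionForm (S : AlmostHypercomplexNH m M)
    (nabla : CovariantDerivative (𝓡 m) (EuclideanSpace ℝ (Fin m))
      (TangentSpace (𝓡 m) : M → Type _))
    (om : ∀ p : M, TangentSpace (𝓡 m) p →L[ℝ] ℝ) : Prop where
  smooth : SmoothOneFormOn om Set.univ
  deriv_J₁ : ∀ p x y, covDerivEndo nabla S.J₁ p x y = 0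
  deriv_J₂ : ∀ p x y, covDerivEndo nabla S.J₂ p x y = om p x • S.J₃ p y
  deriv_J₃ : ∀ p x y, covDerivEndo nabla S.J₃ p x y = -(om p x • S.J₂ p y)

/-- The local 1-forms agree where they are both defined, since `J₃ ≠ 0`, and so define a global
connection form. -/
theorem exists_isConnectionForm (hm : 0 < m) (hF : IsDeterminedByOneForm S nabla) :
    ∃ om, IsConnectionForm S nabla om := by
  choose U hU hpU om hom h using hF
  have agree (p q : M) (hq : q ∈ U p) : om q q = om p q := by
    obtain ⟨y, hy⟩ := exists_tangentVector_ne_zero hm q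
    ext x
    refine smul_left_injective ℝ (S.J₃_ne_zero hy) ?_
    change om q q x • S.J₃ q y = om p q x • S.J₃ q y
    rw [← (h q q (hpU q) x y).2.1, ← (h p q hq x y).2.1]
  refine ⟨fun p => om p p, ?_, fun p x y => (h p p (hpU p) x y).1,
    fun p x y => (h p p (hpU p) x y).2.1, fun p x y => (h p p (hpU p) x y).2.2.1⟩
  refine contMDiffOn_univ.mpr fun p => ?_
  refine ((hom p).contMDiffAt ((hU p).mem_nhds (hpU p))).congr_of_eventuallyEq ?_
  filter_upwards [(hU p).mem_nhds (hpU p)] with q hq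
  rw [agree p q hq]

theorem IsConnectionForm.nabla_J₁ (h : IsConnectionForm S nabla om) (hY : SmoothField Y) (p : M)
    (x : TangentSpace (𝓡 m) p) :
    nabla (fun q => S.J₁ q (Y q)) p x = S.J₁ p (nabla Y p x) := by
  rw [nabla_endo S.smooth_J₁ hY, h.deriv_J₁, add_zero]

theorem IsConnectionForm.curvatureField_J₁ (h : IsConnectionForm S nabla om)
    (hLC : IsLeviCivita S.g nabla) (hX : SmoothField X) (hY : SmoothField Y) (hZ : SmoothField Z)
    (p : M) : curvatureField nabla X Y (fun q => S.J₁ q (Z q)) p =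
      S.J₁ p (curvatureField nabla X Y Z p) := by
  have second {A B : ∀ p : M, TangentSpace (𝓡 m) p} (hB : SmoothField B) :
      nabla (fun q => nabla (fun q => S.J₁ q (Z q)) q (B q)) p (A p) =
        S.J₁ p (nabla (fun q => nabla Z q (B q)) p (A p)) := by
    rw [← h.nabla_J₁ (hZ.covDeriv hLC.smooth hB)]
    exact congrArg (fun W => nabla W p (A p)) (funext fun q => h.nabla_J₁ hZ q (B q))
  rw [curvatureField, second (A := X) hY, second (A := Y) hX, h.nabla_J₁ hZ, curvatureField,
    map_sub, map_sub]

theorem IsConnectionForm.curvatureField_J₂ (h : IsConnectionForm S nabla om)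
    (hLC : IsLeviCivita S.g nabla) (hX : SmoothField X) (hY : SmoothField Y) (hZ : SmoothField Z)
    (p : M) : curvatureField nabla X Y (fun q => S.J₂ q (Z q)) p =
      S.J₂ p (curvatureField nabla X Y Z p) + extDerivField om X Y p • S.J₃ p (Z p) := by
  have first (q : M) (x : TangentSpace (𝓡 m) q) : nabla (fun q => S.J₂ q (Z q)) q x =
      S.J₂ q (nabla Z q x) + om q x • S.J₃ q (Z q) := by
    rw [nabla_endo S.smooth_J₂ hZ, h.deriv_J₂]
  have second {A B : ∀ p : M, TangentSpace (𝓡 m) p} (hB : SmoothField B) :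
      nabla (fun q => nabla (fun q => S.J₂ q (Z q)) q (B q)) p (A p) =
        S.J₂ p (nabla (fun q => nabla Z q (B q)) p (A p)) +
          om p (A p) • S.J₃ p (nabla Z p (B p)) +
        (om p (B p) • (S.J₃ p (nabla Z p (A p)) - om p (A p) • S.J₂ p (Z p)) +
          mvfderiv (𝓡 m) (fun q => om q (B q)) p (A p) • S.J₃ p (Z p)) := by
    have hZB := hZ.covDeriv hLC.smooth hB
    have hJ₃ := S.smooth_J₃.smoothField hZ
    have hω := h.smooth.contMDiff_apply hB
    have e : (fun q => nabla (fun q => S.J₂ q (Z q)) q (B q)) =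
        (fun q => S.J₂ q (nabla Z q (B q))) + (fun q => om q (B q)) • fun q => S.J₃ q (Z q) :=
      funext fun q => first q (B q)
    rw [e, nabla_add (S.smooth_J₂.smoothField hZB) (hJ₃.smul hω), add_apply, nabla_smul hω hJ₃,
      nabla_endo S.smooth_J₂ hZB, h.deriv_J₂, nabla_endo S.smooth_J₃ hZ, h.deriv_J₃,
      ← sub_eq_add_neg]
  rw [curvatureField, second (A := X) hY, second (A := Y) hX, first, curvatureField, map_sub,
    map_sub, extDerivField]
  module

/-- The fundamental form `Ω(X, Y) = g(J₁X, Y)` is closed, because it is parallel for a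
torsion-free connection. -/
theorem IsConnectionForm.fundamentalForm_closed (h : IsConnectionForm S nabla om)
    (hLC : IsLeviCivita S.g nabla) (hX : SmoothField X) (hY : SmoothField Y) (hZ : SmoothField Z)
    (p : M) :
    mvfderiv (𝓡 m) (fun q => S.g q (S.J₁ q (Y q)) (Z q)) p (X p) +
        mvfderiv (𝓡 m) (fun q => S.g q (S.J₁ q (Z q)) (X q)) p (Y p) +
        mvfderiv (𝓡 m) (fun q => S.g q (S.J₁ q (X q)) (Y q)) p (Z p) =
      S.g p (S.J₁ p (mlieBracket (𝓡 m) X Y p)) (Z p) +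
        S.g p (S.J₁ p (mlieBracket (𝓡 m) Y Z p)) (X p) +
        S.g p (S.J₁ p (mlieBracket (𝓡 m) Z X p)) (Y p) := by
  have skew (x y : TangentSpace (𝓡 m) p) : S.g p (S.J₁ p x) y = -S.g p (S.J₁ p y) x := by
    have := S.g_J₁ p x (S.J₁ p y)
    rw [S.sq₁, map_neg, S.g_symm p x] at this
    linarith
  rw [hLC.mvfderiv_metric (S.smooth_J₁.smoothField hY) hZ,
    hLC.mvfderiv_metric (S.smooth_J₁.smoothField hZ) hX,
    hLC.mvfderiv_metric (S.smooth_J₁.smoothField hX) hY, h.nabla_J₁ hX, h.nabla_J₁ hY,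
    h.nabla_J₁ hZ, ← hLC.nabla_sub_nabla hX hY, ← hLC.nabla_sub_nabla hY hZ,
    ← hLC.nabla_sub_nabla hZ hX]
  simp only [map_sub, sub_apply]
  rw [skew (X p) (nabla Y p (Z p)), skew (Y p) (nabla Z p (X p)), skew (Z p) (nabla X p (Y p))]
  ring

variable [T2Space M]

/-- At each point, the curvature and the values of `dω` satisfy the algebraic relations of
`IsNHCurvature`. In particular `dω(X, Y)` depends only on the values of `X` and `Y`, since it is
determined by the commutator of `R(X, Y)` and `J₂`. -/
theorem IsConnectionForm.exists_isNHCurvature (h : IsConnectionForm S nabla om) (hm : 0 < m)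
    (hLC : IsLeviCivita S.g nabla) (p : M) :
    ∃ R σ, IsNHCurvature (toBilinForm (S.g p)) (S.J₁ p : TangentSpace (𝓡 m) p →ₗ[ℝ] _)
        (S.J₂ p) (S.J₃ p) R σ ∧
      (∀ x y z, R x y z = curvature nabla p x y z) ∧
      ∀ X Y, SmoothField X → SmoothField Y → extDerivField om X Y p = σ (X p) (Y p) := by
  have ceq {X Y Z : ∀ p : M, TangentSpace (𝓡 m) p} (hX : SmoothField X) (hY : SmoothField Y)
      (hZ : SmoothField Z) :
      curvature nabla p (X p) (Y p) (Z p) = curvatureField nabla X Y Z p :=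
    curvature_eq_curvatureField hLC S.smoothBilin S.g_symm S.g_nondeg hX hY hZ p
  have comm {X Y : ∀ p : M, TangentSpace (𝓡 m) p} (hX : SmoothField X) (hY : SmoothField Y)
      (z : TangentSpace (𝓡 m) p) : curvature nabla p (X p) (Y p) (S.J₂ p z) =
      S.J₂ p (curvature nabla p (X p) (Y p) z) + extDerivField om X Y p • S.J₃ p z := by
    obtain ⟨Z, hZ, rfl⟩ := exists_smoothField_apply p z
    rw [ceq hX hY hZ, ← h.curvatureField_J₂ hLC hX hY hZ,
      ← ceq hX hY (S.smooth_J₂.smoothField hZ)]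
  obtain ⟨R, hR⟩ := exists_linear_eq_curvature hLC S.smoothBilin S.g_symm S.g_nondeg p
  choose E hE hEp using exists_smoothField_apply (M := M) (m := m) p
  refine ⟨R, fun x y => extDerivField om (E x) (E y) p, ?_, hR, fun X Y hX hY => ?_⟩
  · constructor
    case symm => exact S.g_symm p
    case nondeg => exact S.g_nondeg p
    case sq₁ => exact S.sq₁ p
    case sq₂ => exact S.sq₂ p
    case sq₃ => exact S.sq₃ p
    case mul₂₃ => exact S.mul₂₃ p
    case mul₃₂ => exact S.mul₃₂ p
    case mul₃₁ => exact S.mul₃₁ p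
    case mul₁₂ => exact S.mul₁₂ p
    case g_J₁ => exact S.g_J₁ p
    case g_J₂ => exact S.g_J₂ p
    case antisymm => exact fun x y z => by rw [hR, hR, curvature_antisymm]
    case skew =>
      exact fun x y z w => by
        rw [hR, hR]
        exact curvature_skew hLC S.smoothBilin S.g_symm S.g_nondeg p x y z w
    case bianchi =>
      exact fun x y z => by
        rw [hR, hR, hR, curvature_bianchi hLC S.smoothBilin S.g_symm S.g_nondeg]
    case comm₁ =>
      intro x y z
      obtain ⟨Z, hZ, rfl⟩ := exists_smoothField_apply p z
      have := h.curvatureField_J₁ hLC (hE x) (hE y) hZ p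
      rw [← ceq (hE x) (hE y) hZ, ← ceq (hE x) (hE y) (S.smooth_J₁.smoothField hZ), hEp, hEp]
        at this
      rw [hR, hR]
      exact this
    case comm₂ =>
      intro x y z
      have := comm (hE x) (hE y) z
      rw [hEp, hEp] at this
      rw [hR, hR]
      exact this
  · obtain ⟨y, hy⟩ := exists_tangentVector_ne_zero hm p
    refine smul_left_injective ℝ (S.J₃_ne_zero hy) ?_
    have e₁ := comm hX hY y
    have e₂ := comm (hE (X p)) (hE (Y p)) y
    rw [hEp, hEp, e₁] at e₂
    exact add_left_cancel e₂

end Structure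

/-! ### Constancy of the scalar factor -/

/-- In each fibre the Ricci tensor is a multiple of `g`, and `dω` is a constant multiple of the
same scalar times the fundamental form of `J₁`. -/
theorem IsConnectionForm.exists_einstein_scalar [T2Space M] {S : AlmostHypercomplexNH m M}
    {nabla : CovariantDerivative (𝓡 m) (EuclideanSpace ℝ (Fin m))
      (TangentSpace (𝓡 m) : M → Type _)}
    {om : ∀ p : M, TangentSpace (𝓡 m) p →L[ℝ] ℝ} (h : IsConnectionForm S nabla om) (hm : 4 < m)
    (hLC : IsLeviCivita S.g nabla) :
    ∃ k : M → ℝ, (∀ p y z, ricci S.g nabla p y z = k p * S.g p y z) ∧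
      ∀ X Y, SmoothField X → SmoothField Y → ∀ p,
        m * extDerivField om X Y p = -4 * (k p * S.g p (S.J₁ p (X p)) (Y p)) := by
  have key (p : M) : ∃ k : ℝ, (∀ y z, ricci S.g nabla p y z = k * S.g p y z) ∧
      ∀ X Y, SmoothField X → SmoothField Y →
        m * extDerivField om X Y p = -4 * (k * S.g p (S.J₁ p (X p)) (Y p)) := by
    obtain ⟨R, σ, hRσ, hR, hσ⟩ := h.exists_isNHCurvature (by omega) hLC p
    obtain ⟨k, hk, hk'⟩ := hRσ.exists_scalar (by rwa [finrank_tangentSpace])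
    refine ⟨k, fun y z => ?_, fun X Y hX hY => ?_⟩
    · rw [ricci_eq_ricciTrace (S.g_symm p) (S.g_nondeg p) hR, hk]
      rfl
    · have := hk' (X p) (Y p)
      rw [finrank_tangentSpace] at this
      rw [hσ X Y hX hY]
      exact this
  choose k hk using key
  exact ⟨k, fun p => (hk p).1, fun X Y hX hY p => (hk p).2 X Y hX hY⟩

/-- Near each point the scalar is a constant multiple of `dω(Y, Z) / Ω(Y, Z)` for suitable vector
fields. -/
theorem IsConnectionForm.mdiffAt_einstein_scalar [T2Space M] {S : AlmostHypercomplexNH m M}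
    {nabla : CovariantDerivative (𝓡 m) (EuclideanSpace ℝ (Fin m))
      (TangentSpace (𝓡 m) : M → Type _)}
    {om : ∀ p : M, TangentSpace (𝓡 m) p →L[ℝ] ℝ} (h : IsConnectionForm S nabla om) (hm : 0 < m)
    {k : M → ℝ} (hk : ∀ X Y, SmoothField X → SmoothField Y → ∀ p,
      m * extDerivField om X Y p = -4 * (k p * S.g p (S.J₁ p (X p)) (Y p))) (p : M) :
    MDifferentiableAt (𝓡 m) 𝓘(ℝ, ℝ) k p := by
  obtain ⟨y, hy⟩ := exists_tangentVector_ne_zero hm p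
  obtain ⟨z, hz⟩ : ∃ z, S.g p y z ≠ 0 := by
    by_contra! H
    exact hy (S.g_nondeg p y H)
  obtain ⟨Y, hY, hYp⟩ := exists_smoothField_apply p (-S.J₁ p y)
  obtain ⟨Z, hZ, rfl⟩ := exists_smoothField_apply p z
  have hΩ := S.smoothBilin.contMDiff_apply (S.smooth_J₁.smoothField hY) hZ
  have hne : S.g p (S.J₁ p (Y p)) (Z p) ≠ 0 := by
    rwa [hYp, map_neg, S.sq₁, neg_neg]
  have hd : ContMDiffAt (𝓡 m) 𝓘(ℝ, ℝ) ∞ (fun q => (-4⁻¹ * m * extDerivField om Y Z q) /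
      S.g q (S.J₁ q (Y q)) (Z q)) p :=
    ContMDiffAt.div₀ (contMDiffAt_const.mul (contMDiff_extDerivField h.smooth hY hZ p)) (hΩ p) hne
  refine (hd.mdifferentiableAt (by simp)).congr_of_eventuallyEq ?_
  filter_upwards [(hΩ p).continuousAt.eventually_ne hne] with q hq
  rw [eq_div_iff hq]
  have := hk Y Z hY hZ q
  linarith

/-- Since `dω` and the fundamental form `Ω` are closed, `d(kΩ) = 0` gives `dk ∧ Ω = 0`, and hence
`dk = 0`. -/
theorem IsConnectionForm.mvfderiv_einstein_scalar [T2Space M] {S : AlmostHypercomplexNH m M}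
    {nabla : CovariantDerivative (𝓡 m) (EuclideanSpace ℝ (Fin m))
      (TangentSpace (𝓡 m) : M → Type _)}
    {om : ∀ p : M, TangentSpace (𝓡 m) p →L[ℝ] ℝ} (h : IsConnectionForm S nabla om) (hm : 2 < m)
    (hLC : IsLeviCivita S.g nabla)
    {k : M → ℝ} (hk : ∀ X Y, SmoothField X → SmoothField Y → ∀ p,
      m * extDerivField om X Y p = -4 * (k p * S.g p (S.J₁ p (X p)) (Y p))) (p : M) :
    mvfderiv (𝓡 m) k p = 0 := by
  have kd := h.mdiffAt_einstein_scalar (by omega) hk p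
  have hm0 : (m : ℝ) ≠ 0 := by
    have : 0 < m := by omega
    positivity
  have dω {X Y : ∀ p : M, TangentSpace (𝓡 m) p} (hX : SmoothField X) (hY : SmoothField Y) :
      extDerivField om X Y = fun q => -4 / m * (k q * S.g q (S.J₁ q (X q)) (Y q)) := by
    funext q
    have := hk X Y hX hY q
    field_simp
    linarith
  have deriv {X Y : ∀ p : M, TangentSpace (𝓡 m) p} (hX : SmoothField X) (hY : SmoothField Y)
      (x : TangentSpace (𝓡 m) p) : mvfderiv (𝓡 m) (extDerivField om X Y) p x =
      -4 / m * (k p * mvfderiv (𝓡 m) (fun q => S.g q (S.J₁ q (X q)) (Y q)) p x +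
        S.g p (S.J₁ p (X p)) (Y p) * mvfderiv (𝓡 m) k p x) := by
    have hΩ := mdiffAt_of_contMDiff
      (S.smoothBilin.contMDiff_apply (S.smooth_J₁.smoothField hX) hY) p
    have hkΩ : MDifferentiableAt (𝓡 m) 𝓘(ℝ, ℝ)
        (fun q => k q * S.g q (S.J₁ q (X q)) (Y q)) p := kd.mul hΩ
    rw [dω hX hY, mvfderiv_fun_mul mdifferentiableAt_const hkΩ, mvfderiv_const,
      mvfderiv_fun_mul kd hΩ]
    simp
    ring
  have skew (x y : TangentSpace (𝓡 m) p) : S.g p (S.J₁ p x) y = -S.g p x (S.J₁ p y) := by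
    have := S.g_J₁ p x (S.J₁ p y)
    rw [S.sq₁, map_neg] at this
    linarith
  have hB : (toBilinForm (S.g p)).Nondegenerate :=
    ⟨S.g_nondeg p, fun x hx => S.g_nondeg p x fun y => by rw [S.g_symm]; exact hx y⟩
  have := eq_zero_of_wedge_fundamentalForm (g := toBilinForm (S.g p)) hB
    (J := (S.J₁ p : TangentSpace (𝓡 m) p →ₗ[ℝ] _)) (S.g_symm p) (S.g_J₁ p) skew
    (by rwa [finrank_tangentSpace]) (φ := (mvfderiv (𝓡 m) k p).toLinearMap) ?_
  · ext x
    exact congrArg (fun φ => φ x) this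
  · intro x y z
    obtain ⟨X, hX, rfl⟩ := exists_smoothField_apply p x
    obtain ⟨Y, hY, rfl⟩ := exists_smoothField_apply p y
    obtain ⟨Z, hZ, rfl⟩ := exists_smoothField_apply p z
    have c₁ := extDerivField_closed h.smooth hX hY hZ p
    have c₂ := h.fundamentalForm_closed hLC hX hY hZ p
    rw [deriv hY hZ, deriv hZ hX, deriv hX hY, dω (hX.mlieBracket hY) hZ,
      dω (hY.mlieBracket hZ) hX, dω (hZ.mlieBracket hX) hY] at c₁
    change mvfderiv (𝓡 m) k p (X p) * S.g p (S.J₁ p (Y p)) (Z p) +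
      mvfderiv (𝓡 m) k p (Y p) * S.g p (S.J₁ p (Z p)) (X p) +
      mvfderiv (𝓡 m) k p (Z p) * S.g p (S.J₁ p (X p)) (Y p) = 0
    refine (mul_eq_zero.mp ?_).resolve_left (div_ne_zero (by norm_num : (-4 : ℝ) ≠ 0) hm0)
    linear_combination c₁ - (-4 / m * k p) * c₂

theorem isLocallyConstant_of_mvfderiv_eq_zero {f : M → ℝ}
    (hf : ∀ p, MDifferentiableAt (𝓡 m) 𝓘(ℝ, ℝ) f p) (h₀ : ∀ p, mvfderiv (𝓡 m) f p = 0) :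
    IsLocallyConstant f := by
  have hf' (p : M) : HasMFDerivAt (𝓡 m) 𝓘(ℝ, ℝ) f p 0 := by
    have h := (hf p).hasMFDerivAt
    have e : mfderiv (𝓡 m) 𝓘(ℝ, ℝ) f p = 0 := h₀ p
    rwa [e] at h
  refine IsLocallyConstant.iff_eventually_eq f |>.mpr fun p => ?_
  let φ := extChartAt (𝓡 m) p
  have hF {y : EuclideanSpace ℝ (Fin m)} (hy : y ∈ φ.target) :
      HasFDerivAt (f ∘ φ.symm) (0 : EuclideanSpace ℝ (Fin m) →L[ℝ] ℝ) y := by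
    have h₁ := ((contMDiffOn_extChartAt_symm (I := 𝓡 m) (n := ∞) p).contMDiffAt
      ((isOpen_extChartAt_target p).mem_nhds hy)).mdifferentiableAt (by simp) |>.hasMFDerivAt
    have h₂ := (hf' (φ.symm y)).comp y h₁
    rw [ContinuousLinearMap.zero_comp] at h₂
    exact hasMFDerivAt_iff_hasFDerivAt.mp h₂
  obtain ⟨r, hr, hball⟩ := Metric.isOpen_iff.mp (isOpen_extChartAt_target (I := 𝓡 m) p) _
    (mem_extChartAt_target p)
  have hd : ∀ y ∈ Metric.ball (φ p) r, HasFDerivAt (f ∘ φ.symm)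
    (0 : EuclideanSpace ℝ (Fin m) →L[ℝ] ℝ) y := fun y hy => hF (hball hy)
  filter_upwards [(continuousAt_extChartAt (I := 𝓡 m) p).preimage_mem_nhds
    (Metric.ball_mem_nhds _ hr), extChartAt_source_mem_nhds (I := 𝓡 m) p] with q hq hqs
  have e := Metric.isOpen_ball.is_const_of_fderiv_eq_zero (convex_ball _ _).isPreconnected
    (fun y hy => (hd y hy).differentiableAt.differentiableWithinAt)
    (fun y hy => (hd y hy).fderiv) hq (Metric.mem_ball_self hr)
  simp only [Function.comp_apply] at e
  rwa [φ.left_inv hqs, φ.left_inv (mem_extChartAt_source p)] at e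

end NHGeometry

end

theorem proposition4p3 {n : ℕ} (hn : 2 ≤ n) {M : Type*} [TopologicalSpace M] [T2Space M]
    [SecondCountableTopology M] [ChartedSpace (EuclideanSpace ℝ (Fin (4 * n))) M]
    [IsManifold (𝓡 (4 * n)) ∞ M]
    (S : NHGeometry.AlmostHypercomplexNH (4 * n) M)
    (nabla : CovariantDerivative (𝓡 (4 * n)) (EuclideanSpace ℝ (Fin (4 * n)))
      (TangentSpace (𝓡 (4 * n)) : M → Type _))
    (hLC : NHGeometry.IsLeviCivita S.g nabla)
    (hQK : NHGeometry.IsQuaternionicKahler S nabla)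
    (hF : NHGeometry.IsDeterminedByOneForm S nabla) :
    (∀ p : M, ∀ q ∈ connectedComponent p,
      NHGeometry.scalarCurvature S.g nabla q = NHGeometry.scalarCurvature S.g nabla p) ∧
    NHGeometry.IsParallelTwoTensor nabla (NHGeometry.ricci S.g nabla) := by
  obtain ⟨om, hom⟩ := NHGeometry.exists_isConnectionForm (by omega) hF
  obtain ⟨k, hρ, hk⟩ := hom.exists_einstein_scalar (by omega) hLC
  have kd := hom.mdiffAt_einstein_scalar (by omega) hk
  have dk := hom.mvfderiv_einstein_scalar (by omega) hLC hk
  have hρ' (p : M) : NHGeometry.ricci S.g nabla p = fun y z => k p * S.g p y z := by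
    funext y z
    exact hρ p y z
  refine ⟨fun p q hq => ?_, fun p Y Z hY hZ => ?_⟩
  · rw [NHGeometry.scalarCurvature, NHGeometry.scalarCurvature, hρ', hρ',
      NHGeometry.metricTrace_smul_self (S.g_symm q) (S.g_nondeg q),
      NHGeometry.metricTrace_smul_self (S.g_symm p) (S.g_nondeg p),
      (NHGeometry.isLocallyConstant_of_mvfderiv_eq_zero kd dk).apply_eq_of_isPreconnected
        isPreconnected_connectedComponent hq mem_connectedComponent]
  · obtain ⟨hg, hg'⟩ := hLC.metric p Y Z hY hZ
    simp only [hρ']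
    refine ⟨(kd p).mul hg, fun x => ?_⟩
    rw [mvfderiv_fun_mul (kd p) hg, dk]
    simp [hg', mul_add]
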